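/- Let $N\ge 1$, let $\Sigma$ be a finite set (the values of the spin coordinate), and let $V\ne\{0\}$ be a subspace of $\mathbb C^{\Sigma^N}$ that is invariant under permutations of the $N$ spin coordinates (the admitted spin states). Special cases: $\Sigma$ a point and $V=\mathbb C$ (spin omitted); $\Sigma=\{\uparrow,\downarrow\}$ and $V=\mathbb C^{\Sigma^N}$ (global ground state of $N$ electrons); $\Sigma=\{\uparrow,\downarrow\}$ and $V$ the singlet subspace $S^2=0$ ($N$ even), or the eigenspace of any other attained value of $S^2$. Let $\mathcal W_N$ be the set of antisymmetric functions $\psi(\mathbf r_1,s_1,\dots,\mathbf r_N,s_N)$ on $(\mathbb R^3\times\Sigma)^N$ with $\|\psi\|_2=1$, with weak gradient in $L^2$ (finite kinetic energy), and with $\psi(\mathbf r_1,\cdot,\dots,\mathbf r_N,\cdot)\in V$ for almost every $(\mathbf r_1,\dots,\mathbf r_N)$. Let $\mathcal D_N$ be the set of mixed states $\gamma=\sum_m p_m|\psi_m\rangle\langle\psi_m|$ with countably many $\psi_m\in\mathcal W_N$, $p_m\ge0$, $\sum_m p_m=1$, $\operatorname{tr}(\gamma T(\mathbf 0))<\infty$.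 For $\lambda\ge 0$, $v:\mathbb R^3\to\mathbb R$ and $\mathbf A:\mathbb R^3\to\mathbb R^3$ put (as quadratic forms) $$H^\lambda(v,\mathbf A)=T(\mathbf A)+\lambda\sum_{l<k}\frac1{|\mathbf r_k-\mathbf r_l|}+\sum_{k=1}^N v(\mathbf r_k),\qquad T(\mathbf A)=\frac12\sum_{k=1}^N\left(-i\nabla_{\mathbf r_k}+\mathbf A(\mathbf r_k)\right)^2 .$$ For $\psi\in\mathcal W_N$ let $\rho_\psi(\mathbf r_1)=N\int|\psi|^2\,d\mathbf r_2\cdots d\mathbf r_N$ and $\mathbf j_\psi(\mathbf r_1)=N\,\mathrm{Im}\int\psi^*\nabla_{\mathbf r_1}\psi\,d\mathbf r_2\cdots d\mathbf r_N$ (summed over spins), and extend both linearly to $\mathcal D_N$. Let $F^\lambda_{\mathrm{VR}}(\rho,\mathbf j)=\inf\langle\psi,H^\lambda(0,\mathbf 0)\psi\rangle$ over $\psi\in\mathcal W_N$ with $(\rho_\psi,\mathbf j_\psi)=(\rho,\mathbf j)$, and $F^\lambda_{\mathrm{VR,DM}}(\rho,\mathbf j)=\inf\operatorname{tr}(\gamma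 H^\lambda(0,\mathbf 0))$ over $\gamma\in\mathcal D_N$ with $(\rho_\gamma,\mathbf j_\gamma)=(\rho,\mathbf j)$, where $\inf\emptyset=+\infty$. The ground-state energy $E^\lambda(v,\mathbf A)$ is given by any one of the expressions (a) $\inf_{\psi\in\mathcal W_N}\langle\psi,H^\lambda(v,\mathbf A)\psi\rangle$; (b) $\inf_{\gamma\in\mathcal D_N}\operatorname{tr}(\gamma H^\lambda(v,\mathbf A))$; (c) $\inf_{(\rho,\mathbf j)\in X\times Y}\left\{F(\rho,\mathbf j)+\int\mathbf A\cdot\mathbf j\,d\mathbf r+\int\left(v+\tfrac12|\mathbf A|^2\right)\rho\,d\mathbf r\right\}$ with $F=F^\lambda_{\mathrm{VR}}$, $F=F^\lambda_{\mathrm{VR,DM}}$, or $F=F^\lambda$ the generalized Lieb functional $F^\lambda(\rho,\mathbf j)=\sup_{(u,\mathbf A)\in X^*\times Y^*}\left\{\bar E^\lambda(u,\mathbf A)-\int\mathbf A\cdot\mathbf j\,d\mathbf r-\int u\rho\,d\mathbf r\right\}$, with the $\bar E^\lambda$ that belongs to (a). For each expression put $\bar E^\lambda(u,\mathbf A)=E^\lambda\left(u-\tfrac12|\mathbf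 A|^2,\mathbf A\right)$. Then, for every $\lambda\ge0$ (in particular for the interacting case $\lambda=1$ and the non-interacting case $\lambda=0$), and for $E^\lambda$ given by each of these expressions: 1. With the density space $X\times Y=(L^1\cap L^3)\times(L^1\cap L^{3/2})^3$ on $\mathbb R^3$ and $X^*\times Y^*=(L^{3/2}+L^\infty)\times(L^3+L^\infty)^3$, the numbers $E^\lambda(v,\mathbf A)$ and $\bar E^\lambda(u,\mathbf A)$ are finite (neither $-\infty$ nor $+\infty$) for all $(v,\mathbf A)$ and $(u,\mathbf A)$ in $X^*\times Y^*$. 2. With the density space $X\times Y=L^3\times(L^{3/2})^3$ and $X^*\times Y^*=L^{3/2}\times(L^3)^3$, the numbers $E^\lambda(v,\mathbf A)$ and $\bar E^\lambda(u,\mathbf A)$ are finite for all $(v,\mathbf A)$ and $(u,\mathbf A)$ in $X^*\times Y^*$. -/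

import Mathlib

open MeasureTheory
open scoped ENNReal NNReal ContDiff ComplexConjugate

noncomputable section

namespace CDFT

/-- Physical space `ℝ³` with the Euclidean norm and Lebesgue measure. -/
abbrev E3 := EuclideanSpace ℝ (Fin 3)

/-- Positions of `N` particles; the measure is the product (Lebesgue) measure of `ℝ^{3N}`. -/
abbrev Config (N : ℕ) := Fin N → E3

/-- Spin coordinates of `N` particles. -/
abbrev SpinConfig (σ : Type*) (N : ℕ) := Fin N → σ

/-- `g` is the weak (distributional) derivative of `f` in the direction `e`. -/
def HasWeakDeriv {N : ℕ} (f g : Config N → ℂ) (e : Config N) : Prop :=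
  ∀ φ : Config N → ℝ, ContDiff ℝ ∞ φ → HasCompactSupport φ →
    ∫ x, ((fderiv ℝ φ x e : ℝ) : ℂ) * f x = - ∫ x, ((φ x : ℝ) : ℂ) * g x

/-- The coordinate direction of `ℝ^{3N}` belonging to the `k`-th component of particle `i`. -/
def coordDir {N : ℕ} (i : Fin N) (k : Fin 3) : Config N :=
  Pi.single i (EuclideanSpace.single k (1 : ℝ))

/-- The set `W_N` of admissible wavefunctions: `L²`-normalised antisymmetric functions of space and
spin coordinates with weak gradient in `L²` (finite kinetic energy). The weak gradient, which is
unique almost everywhere, is carried along: `grad i k` is the derivative in `coordDir i k`.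

`σ` is the set of values of the spin coordinate and `V` the space of admitted spin states:
* `σ` a one-point type, `V = ⊤`: the spin coordinate is omitted;
* `σ` a two-point type, `V = ⊤`: electrons, the global ground state;
* `σ` a two-point type, `V` the kernel of `S²`: the lowest singlet state (and similarly for any
  other prescribed value of `S²`). -/
structure Wavefunction (N : ℕ) (σ : Type*) [Fintype σ]
    (V : Submodule ℂ (SpinConfig σ N → ℂ)) where
  /-- the wavefunction -/
  toFun : Config N → SpinConfig σ N → ℂ
  /-- its weak gradient -/
  grad : Fin N → Fin 3 → Config N → SpinConfig σ N → ℂ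
  memLp : ∀ s, MemLp (fun x => toFun x s) 2 volume
  grad_memLp : ∀ i k s, MemLp (fun x => grad i k x s) 2 volume
  hasWeakDeriv : ∀ i k s,
    HasWeakDeriv (fun x => toFun x s) (fun x => grad i k x s) (coordDir i k)
  normalized : ∑ s, ∫⁻ x, ‖toFun x s‖ₑ ^ 2 = 1
  antisymm : ∀ τ : Equiv.Perm (Fin N), ∀ᵐ x : Config N, ∀ s : SpinConfig σ N,
    toFun (x ∘ τ) (s ∘ τ) = ((Equiv.Perm.sign τ : ℤ) : ℂ) * toFun x s
  spin_mem : ∀ᵐ x : Config N, toFun x ∈ V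

section Energies

variable {N : ℕ} {σ : Type*} [Fintype σ] {V : Submodule ℂ (SpinConfig σ N → ℂ)}

/-- `⟨ψ, T(A) ψ⟩ = ½ ∑ₖ ‖(-i∇ₖ + A(rₖ)) ψ‖²`. For `A = 0` this is the kinetic energy `K(ψ)`. -/
def kinetic (A : E3 → E3) (ψ : Wavefunction N σ V) : ℝ≥0∞ :=
  2⁻¹ * ∑ i, ∑ k, ∑ s, ∫⁻ x,
    ‖-Complex.I * ψ.grad i k x s + ((A (x i) k : ℝ) : ℂ) * ψ.toFun x s‖ₑ ^ 2

/-- `⟨ψ, W ψ⟩` for the electron-electron repulsion `W = ∑_{l < k} 1 / |rₖ - rₗ|`. -/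
def coulomb (ψ : Wavefunction N σ V) : ℝ≥0∞ :=
  ∑ s, ∫⁻ x, (∑ k, ∑ l ∈ Finset.Iio k, ENNReal.ofReal ‖x k - x l‖⁻¹) * ‖ψ.toFun x s‖ₑ ^ 2

/-- `⟨ψ, H^λ(0,0) ψ⟩ = ⟨ψ, (T(0) + λ W) ψ⟩`. -/
def universalEnergy (lam : ℝ) (ψ : Wavefunction N σ V) : ℝ≥0∞ :=
  kinetic 0 ψ + ENNReal.ofReal lam * coulomb ψ

/-- The contribution of the positive part of a scalar potential:
`⟨ψ, ∑ₖ v⁺(rₖ) ψ⟩`. The negative part is `positivePotential (-v)`. -/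
def positivePotential (v : E3 → ℝ) (ψ : Wavefunction N σ V) : ℝ≥0∞ :=
  ∑ s, ∫⁻ x, (∑ k, ENNReal.ofReal (v (x k))) * ‖ψ.toFun x s‖ₑ ^ 2

/-- `⟨ψ, H^λ(v,A) ψ⟩` as an extended real number (the undefined `∞ - ∞` is read as `-∞`). -/
def energy (lam : ℝ) (v : E3 → ℝ) (A : E3 → E3) (ψ : Wavefunction N σ V) : EReal :=
  ((kinetic A ψ + ENNReal.ofReal lam * coulomb ψ + positivePotential v ψ : ℝ≥0∞) : EReal)
    - ((positivePotential (-v) ψ : ℝ≥0∞) : EReal)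

/-- The set `D_N` of mixed states `γ = ∑ₙ pₙ |ψₙ⟩⟨ψₙ|` with `tr(γ T(0)) < ∞`, given by a convex
decomposition (weights may vanish, so finite mixtures are included). -/
structure MixedState (N : ℕ) (σ : Type*) [Fintype σ]
    (V : Submodule ℂ (SpinConfig σ N → ℂ)) where
  weight : ℕ → ℝ≥0
  state : ℕ → Wavefunction N σ V
  hasSum_weight : HasSum weight 1
  kinetic_ne_top : ∑' m, (weight m : ℝ≥0∞) * kinetic 0 (state m) ≠ ⊤

/-- `tr(γ H^λ(0,0))`. -/
def mixedUniversalEnergy (lam : ℝ) (γ : MixedState N σ V) : ℝ≥0∞ :=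
  ∑' m, (γ.weight m : ℝ≥0∞) * universalEnergy lam (γ.state m)

/-- `tr(γ H^λ(v,A))` as an extended real number (the undefined `∞ - ∞` is read as `-∞`). -/
def mixedEnergy (lam : ℝ) (v : E3 → ℝ) (A : E3 → E3) (γ : MixedState N σ V) : EReal :=
  ((∑' m, (γ.weight m : ℝ≥0∞) * (kinetic A (γ.state m)
      + ENNReal.ofReal lam * coulomb (γ.state m) + positivePotential v (γ.state m)) : ℝ≥0∞) : EReal)
    - ((∑' m, (γ.weight m : ℝ≥0∞) * positivePotential (-v) (γ.state m) : ℝ≥0∞) : EReal)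

/-- Ground-state energy `E^λ(v,A) = inf_{ψ ∈ W_N} ⟨ψ, H^λ(v,A) ψ⟩`. -/
def groundEnergy (V : Submodule ℂ (SpinConfig σ N → ℂ)) (lam : ℝ)
    (v : E3 → ℝ) (A : E3 → E3) : EReal :=
  ⨅ ψ : Wavefunction N σ V, energy lam v A ψ

/-- Ground-state energy through mixed states, `E^λ(v,A) = inf_{γ ∈ D_N} tr(γ H^λ(v,A))`. -/
def groundEnergyMixed (V : Submodule ℂ (SpinConfig σ N → ℂ)) (lam : ℝ)
    (v : E3 → ℝ) (A : E3 → E3) : EReal :=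
  ⨅ γ : MixedState N σ V, mixedEnergy lam v A γ

end Energies

/-- The change of variables `u = v + ½|A|²`: from `E(v,A)` to `Ē(u,A) = E(u - ½|A|², A)`. -/
def convexified (E : (E3 → ℝ) → (E3 → E3) → EReal) (u : E3 → ℝ) (A : E3 → E3) : EReal :=
  E (fun r => u r - 1 / 2 * ‖A r‖ ^ 2) A

section Densities

variable {n : ℕ} {σ : Type*} [Fintype σ] {V : Submodule ℂ (SpinConfig σ (n + 1) → ℂ)}

/-- Particle density `ρ_ψ(r₁) = N ∫ |ψ|² dr₂ … dr_N` of a wavefunction of `N = n + 1` particles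
(with summation over spins). -/
def density (ψ : Wavefunction (n + 1) σ V) (r : E3) : ℝ :=
  (n + 1 : ℝ) * ∑ s, ∫ y : Config n, ‖ψ.toFun (Fin.cons r y) s‖ ^ 2

/-- Paramagnetic current density `j_ψ(r₁) = N Im ∫ ψ* ∇_{r₁} ψ dr₂ … dr_N`. -/
def current (ψ : Wavefunction (n + 1) σ V) (r : E3) : E3 :=
  WithLp.toLp 2 fun k => (n + 1 : ℝ) *
    (∑ s, ∫ y : Config n, conj (ψ.toFun (Fin.cons r y) s) * ψ.grad 0 k (Fin.cons r y) s).im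

/-- `ψ ↦ (ρ, j)`. -/
def HasDensities (ψ : Wavefunction (n + 1) σ V) (ρ : E3 → ℝ) (j : E3 → E3) : Prop :=
  density ψ =ᵐ[volume] ρ ∧ current ψ =ᵐ[volume] j

/-- `γ ↦ (ρ, j)`. -/
def MixedHasDensities (γ : MixedState (n + 1) σ V) (ρ : E3 → ℝ) (j : E3 → E3) : Prop :=
  ∀ᵐ r : E3, HasSum (fun m => (γ.weight m : ℝ) * density (γ.state m) r) (ρ r) ∧
    HasSum (fun m => (γ.weight m : ℝ) • current (γ.state m) r) (j r)

/-- The pure-state constrained-search functional `F^λ_VR(ρ, j)`, with value `+∞` if `(ρ, j)` is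
not representable. -/
def constrainedSearch (V : Submodule ℂ (SpinConfig σ (n + 1) → ℂ)) (lam : ℝ)
    (ρ : E3 → ℝ) (j : E3 → E3) : EReal :=
  ⨅ (ψ : Wavefunction (n + 1) σ V) (_ : HasDensities ψ ρ j), ((universalEnergy lam ψ : ℝ≥0∞) : EReal)

/-- The mixed-state constrained-search functional `F^λ_{VR,DM}(ρ, j)`. -/
def constrainedSearchMixed (V : Submodule ℂ (SpinConfig σ (n + 1) → ℂ)) (lam : ℝ)
    (ρ : E3 → ℝ) (j : E3 → E3) : EReal :=
  ⨅ (γ : MixedState (n + 1) σ V) (_ : MixedHasDensities γ ρ j),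
    ((mixedUniversalEnergy lam γ : ℝ≥0∞) : EReal)

/-- The generalized Lieb functional
`F^λ(ρ, j) = sup_{(u,A) ∈ X* × Y*} (Ē^λ(u,A) - ⟨A, j⟩ - ⟨u, ρ⟩)`; `X'` and `Y'` are the dual
spaces, as spaces of functions. -/
def liebFunctional (V : Submodule ℂ (SpinConfig σ (n + 1) → ℂ)) (lam : ℝ)
    (X' : Set (E3 → ℝ)) (Y' : Set (E3 → E3)) (ρ : E3 → ℝ) (j : E3 → E3) : EReal :=
  ⨆ u ∈ X', ⨆ A ∈ Y', convexified (groundEnergy V lam) u A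
    - ((∫ r, inner ℝ (A r) (j r) : ℝ) : EReal) - ((∫ r, u r * ρ r : ℝ) : EReal)

end Densities

/-- The energy obtained from a density functional `F` on the density space `X × Y`:
`inf_{(ρ,j) ∈ X × Y} (F(ρ,j) + ⟨A, j⟩ + ⟨v + ½|A|², ρ⟩)`. -/
def energyFromFunctional (X : Set (E3 → ℝ)) (Y : Set (E3 → E3))
    (F : (E3 → ℝ) → (E3 → E3) → EReal) (v : E3 → ℝ) (A : E3 → E3) : EReal :=
  ⨅ ρ ∈ X, ⨅ j ∈ Y, F ρ j + ((∫ r, inner ℝ (A r) (j r) : ℝ) : EReal)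
    + ((∫ r, (v r + 1 / 2 * ‖A r‖ ^ 2) * ρ r : ℝ) : EReal)

/-- The functions on `ℝ³` of class `L^p`. -/
def lpSpace (F : Type*) [NormedAddCommGroup F] (p : ℝ≥0∞) : Set (E3 → F) :=
  {f | MemLp f p volume}

/-- The functions on `ℝ³` of class `L^p + L^q`. -/
def lpSum (F : Type*) [NormedAddCommGroup F] (p q : ℝ≥0∞) : Set (E3 → F) :=
  {f | ∃ g ∈ lpSpace F p, ∃ h ∈ lpSpace F q, f = g + h}

end CDFT

end

open CDFT

namespace CDFT

open Filter Topology

/-! Finiteness has two halves: a uniform lower bound over all admissible states, and one trial state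
for which every term is finite.

Lower bound. In the coordinate of a single particle, Hölder with exponents 3/2 and 3 and the Sobolev
inequality `‖u‖₆ ≤ C ‖∇u‖₂` bound `∫ |w(xᵢ)| |f|²` by `‖w‖_{3/2}` times the squared H¹ norm of `f`
(`exists_lintegral_coord_mul_sq_le`). A potential in `L^{3/2} + L^∞` is bounded up to an error of
small `L^{3/2}` norm, so it is form-bounded by the kinetic energy with arbitrarily small relative
bound (`exists_potentialForm_le`). For `A` in `L³ + L^∞` the function `|A|²` belongs to the same
class. Hence `T(0) ≤ 4 T(A) + C`, and both the negative part of `v` and the pairing `∫ A·j` are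
absorbed into the kinetic energy. Averaging over the weights gives the bounds for mixed states,
`exists_le_mixedEnergy` and `exists_le_constrainedSearchMixed_add`. The pure-state infima are
larger, since pure states are mixed states, and the Lieb expression is at least the ground-state
energy, by testing its supremum at the given potentials.

Upper bound. Antisymmetrising bumps with well-separated supports, tensored with a nonzero spin
vector of `V`, gives a state `ψ` whose repulsion is bounded and which is locally, for each spin
configuration, a real function times a complex constant (`exists_smooth_wavefunction`). Its current
vanishes and its density is continuous with compact support, so `(ρ, 0)` lies in both density
spaces. Its energy at `(u - ½|A|², A)` is its universal energy plus `∫ uρ`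
(`energy_eq_of_im_eq_zero`). This bounds the ground-state energies, the constrained searches at `(ρ,
0)`, and also the Lieb functional there, because the pairing cancels.

Both choices of spaces are instances of `energies_finite`, which uses only that the potentials are
closed under `u ↦ u ± ½|A|²`. -/

/-! ### Sobolev estimate in one particle coordinate, for smooth functions -/

lemma enorm_clm_sq_le (T : E3 →L[ℝ] ℂ) :
    ‖T‖ₑ ^ 2 ≤ 3 * ∑ k, ‖T (EuclideanSpace.single k (1 : ℝ))‖ₑ ^ 2 := by
  have h1 : ‖T‖ ≤ ∑ k, ‖T (EuclideanSpace.single k (1 : ℝ))‖ := by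
    refine T.opNorm_le_bound (by positivity) fun v => ?_
    have hv : v = ∑ k, v k • EuclideanSpace.single k (1 : ℝ) := by
      ext i
      simp [Fin.sum_univ_three]
      fin_cases i <;> simp
    conv_lhs => rw [hv, map_sum]
    rw [Finset.sum_mul]
    refine (norm_sum_le _ _).trans (Finset.sum_le_sum fun k _ => ?_)
    rw [map_smul, norm_smul, mul_comm]
    gcongr
    exact PiLp.norm_apply_le v k
  have h2 : ‖T‖ ^ 2 ≤ 3 * ∑ k, ‖T (EuclideanSpace.single k (1 : ℝ))‖ ^ 2 := by
    calc ‖T‖ ^ 2 ≤ (∑ k, ‖T (EuclideanSpace.single k (1 : ℝ))‖) ^ 2 := by gcongr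
      _ ≤ _ := by
        simpa using sq_sum_le_card_mul_sum_sq
          (s := Finset.univ) (f := fun k => ‖T (EuclideanSpace.single k (1 : ℝ))‖)
  have h3 : ‖T‖₊ ^ 2 ≤ 3 * ∑ k, ‖T (EuclideanSpace.single k (1 : ℝ))‖₊ ^ 2 := by
    rw [← NNReal.coe_le_coe]
    push_cast
    exact h2
  simp only [enorm_eq_nnnorm]
  exact_mod_cast h3

/-- The constant of the Sobolev inequality `‖u‖₆ ≤ C ‖∇u‖₂` on `ℝ³`. -/
noncomputable def sobolevConst : ℝ≥0 := 3 * (SNormLESNormFDerivOfEqConst ℂ (volume : Measure E3) 2) ^ 2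

lemma eLpNorm_six_le {u : E3 → ℂ} (hu : ContDiff ℝ 1 u) (hc : HasCompactSupport u) :
    eLpNorm u 6 volume ≤
      SNormLESNormFDerivOfEqConst ℂ (volume : Measure E3) 2 * eLpNorm (fderiv ℝ u) 2 volume := by
  have h := eLpNorm_le_eLpNorm_fderiv_of_eq (volume : Measure E3) hu hc (p := 2) (p' := 6)
    (by norm_num) (by simp) (by simp; norm_num)
  exact_mod_cast h

/-- Hölder with the conjugate exponents 3/2 and 3, the second applied to `|u|²`. -/
lemma lintegral_mul_sq_le_eLpNorm (w : E3 → ℝ) (hw : AEStronglyMeasurable w) {u : E3 → ℂ}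
    (hu : AEStronglyMeasurable u) :
    ∫⁻ r, ‖w r‖ₑ * ‖u r‖ₑ ^ 2 ≤ eLpNorm w (3 / 2) volume * eLpNorm u 6 volume ^ 2 := by
  have hpq : (3 / 2 : ℝ).HolderConjugate 3 := by
    rw [Real.holderConjugate_iff]; norm_num
  have h := ENNReal.lintegral_mul_le_Lp_mul_Lq volume hpq hw.enorm (hu.enorm.pow_const 2)
  refine h.trans (le_of_eq ?_)
  have h32 : ((3 / 2 : ℝ≥0∞)).toReal = 3 / 2 := by simp
  have hne : (3 / 2 : ℝ≥0∞) ≠ ⊤ := by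
    simp [ENNReal.div_eq_top]
  rw [eLpNorm_eq_lintegral_rpow_enorm_toReal (by simp) hne,
    eLpNorm_eq_lintegral_rpow_enorm_toReal (by simp) (by simp), h32]
  congr 1
  rw [← ENNReal.rpow_natCast, ← ENNReal.rpow_mul]
  congr 1
  · refine lintegral_congr fun r => ?_
    rw [← ENNReal.rpow_natCast, ← ENNReal.rpow_mul]
    norm_num
  · norm_num

lemma lintegral_mul_sq_le_fderiv (w : E3 → ℝ) (hw : AEStronglyMeasurable w) {u : E3 → ℂ}
    (hu : ContDiff ℝ 1 u) (hc : HasCompactSupport u) :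
    ∫⁻ r, ‖w r‖ₑ * ‖u r‖ₑ ^ 2 ≤ sobolevConst * eLpNorm w (3 / 2) volume *
      ∑ k, ∫⁻ r, ‖fderiv ℝ u r (EuclideanSpace.single k (1 : ℝ))‖ₑ ^ 2 := by
  have hm : Continuous (fderiv ℝ u) := hu.continuous_fderiv (by simp)
  have h2 : eLpNorm (fderiv ℝ u) 2 volume ^ 2 = ∫⁻ r, ‖fderiv ℝ u r‖ₑ ^ 2 := by
    rw [eLpNorm_eq_lintegral_rpow_enorm_toReal (by simp) (by simp), ← ENNReal.rpow_natCast,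
      ← ENNReal.rpow_mul]
    simp
  have h3 : ∫⁻ r, ‖fderiv ℝ u r‖ₑ ^ 2 ≤
      3 * ∑ k, ∫⁻ r, ‖fderiv ℝ u r (EuclideanSpace.single k (1 : ℝ))‖ₑ ^ 2 := by
    have hmk : ∀ k, Measurable fun r =>
        ‖fderiv ℝ u r (EuclideanSpace.single k (1 : ℝ))‖ₑ ^ 2 := fun k => by
      have : Continuous fun r => fderiv ℝ u r (EuclideanSpace.single k (1 : ℝ)) := by fun_prop
      exact this.measurable.enorm.pow_const 2
    rw [← lintegral_finsetSum _ fun k _ => hmk k, ← lintegral_const_mul _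
      (Finset.measurable_sum _ fun k _ => hmk k)]
    exact lintegral_mono fun r => enorm_clm_sq_le _
  calc ∫⁻ r, ‖w r‖ₑ * ‖u r‖ₑ ^ 2
      ≤ eLpNorm w (3 / 2) volume * eLpNorm u 6 volume ^ 2 :=
        lintegral_mul_sq_le_eLpNorm w hw hu.continuous.aestronglyMeasurable
    _ ≤ eLpNorm w (3 / 2) volume * (SNormLESNormFDerivOfEqConst ℂ (volume : Measure E3) 2 *
          eLpNorm (fderiv ℝ u) 2 volume) ^ 2 := by
        gcongr; exact eLpNorm_six_le hu hc
    _ ≤ eLpNorm w (3 / 2) volume * ((SNormLESNormFDerivOfEqConst ℂ (volume : Measure E3) 2) ^ 2 *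
          (3 * ∑ k, ∫⁻ r, ‖fderiv ℝ u r (EuclideanSpace.single k (1 : ℝ))‖ₑ ^ 2)) := by
        rw [mul_pow, h2]; gcongr
    _ = _ := by
        rw [sobolevConst]; push_cast; ring

variable {n : ℕ}

lemma lintegral_insertNth (i : Fin (n + 1)) {G : Config (n + 1) → ℝ≥0∞} (hG : AEMeasurable G) :
    ∫⁻ y : Config n, ∫⁻ r : E3, G (i.insertNth r y) = ∫⁻ x, G x := by
  have hmp := (volume_preserving_piFinSuccAbove (fun _ : Fin (n + 1) => E3) i).symm
  rw [← hmp.lintegral_comp_emb (MeasurableEquiv.measurableEmbedding _), Measure.volume_eq_prod,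
    lintegral_prod_symm]
  · rfl
  · exact hG.comp_quasiMeasurePreserving hmp.quasiMeasurePreserving

lemma lintegral_insertNth' (i : Fin (n + 1)) {G : Config (n + 1) → ℝ≥0∞} (hG : AEMeasurable G) :
    ∫⁻ r : E3, ∫⁻ y : Config n, G (i.insertNth r y) = ∫⁻ x, G x := by
  have hmp := (volume_preserving_piFinSuccAbove (fun _ : Fin (n + 1) => E3) i).symm
  rw [← hmp.lintegral_comp_emb (MeasurableEquiv.measurableEmbedding _), Measure.volume_eq_prod,
    lintegral_prod]
  · rfl
  · exact hG.comp_quasiMeasurePreserving hmp.quasiMeasurePreserving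

lemma quasiMeasurePreserving_coord {N : ℕ} (i : Fin N) :
    Measure.QuasiMeasurePreserving (fun x : Config N => x i) volume volume :=
  Measure.quasiMeasurePreserving_eval (fun _ : Fin N => (volume : Measure E3)) i

/-- Freezing all coordinates but the `i`-th leaves a compactly supported C¹ function on `ℝ³`, to
which the one-particle estimate applies; Tonelli integrates over the frozen coordinates. The
constant therefore does not depend on the number of particles. -/
lemma lintegral_coord_mul_sq_le_fderiv (i : Fin (n + 1)) (w : E3 → ℝ)
    (hw : AEStronglyMeasurable w) {F : Config (n + 1) → ℂ}
    (hF : ContDiff ℝ 1 F) (hc : HasCompactSupport F) :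
    ∫⁻ x, ‖w (x i)‖ₑ * ‖F x‖ₑ ^ 2 ≤ sobolevConst * eLpNorm w (3 / 2) volume *
      ∑ k, ∫⁻ x, ‖fderiv ℝ F x (coordDir i k)‖ₑ ^ 2 := by
  have hwi : AEMeasurable fun x : Config (n + 1) => ‖w (x i)‖ₑ :=
    hw.enorm.comp_quasiMeasurePreserving (quasiMeasurePreserving_coord i)
  have hG : AEMeasurable fun x : Config (n + 1) => ‖w (x i)‖ₑ * ‖F x‖ₑ ^ 2 :=
    hwi.mul (hF.continuous.measurable.enorm.pow_const 2).aemeasurable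
  have hm : Continuous (fderiv ℝ F) := hF.continuous_fderiv (by simp)
  have hD : ∀ k, Measurable fun x => ‖fderiv ℝ F x (coordDir i k)‖ₑ ^ 2 := fun k => by
    have : Continuous fun x => fderiv ℝ F x (coordDir i k) := by fun_prop
    exact this.measurable.enorm.pow_const 2
  have hins : ∀ (y : Config n) (r : E3),
      (i.insertNth r y : Config (n + 1)) = i.insertNth 0 y + Pi.single i r := by
    intro y r
    ext j : 1
    refine Fin.succAboveCases i ?_ (fun j => ?_) j
    · simp
    · simp [Fin.succAbove_ne]
  have hder : ∀ (y : Config n) (r : E3), HasFDerivAt (fun r : E3 => (i.insertNth r y : Config (n+1)))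
      (ContinuousLinearMap.single ℝ (fun _ : Fin (n + 1) => E3) i) r := by
    intro y r
    have : (fun r : E3 => (i.insertNth r y : Config (n+1))) = fun r =>
        i.insertNth 0 y + ContinuousLinearMap.single ℝ (fun _ : Fin (n + 1) => E3) i r := by
      funext r; rw [hins]; rfl
    rw [this]
    exact (ContinuousLinearMap.hasFDerivAt _).const_add _
  have hsl : ∀ y : Config n, ContDiff ℝ 1 fun r : E3 => (i.insertNth r y : Config (n+1)) := by
    intro y
    have : (fun r : E3 => (i.insertNth r y : Config (n+1))) = fun r =>
        i.insertNth 0 y + ContinuousLinearMap.single ℝ (fun _ : Fin (n + 1) => E3) i r := by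
      funext r; rw [hins]; rfl
    rw [this]
    fun_prop
  rw [← lintegral_insertNth i hG]
  calc ∫⁻ y : Config n, ∫⁻ r : E3, ‖w ((i.insertNth r y : Config (n+1)) i)‖ₑ *
        ‖F (i.insertNth r y)‖ₑ ^ 2
      ≤ ∫⁻ y : Config n, sobolevConst * eLpNorm w (3 / 2) volume *
          ∑ k, ∫⁻ r, ‖fderiv ℝ F (i.insertNth r y) (coordDir i k)‖ₑ ^ 2 := by
        refine lintegral_mono fun y => ?_
        simp only [Fin.insertNth_apply_same]
        have hcs : HasCompactSupport fun r : E3 => F (i.insertNth r y) := by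
          refine HasCompactSupport.of_support_subset_isCompact
            (K := (fun x : Config (n+1) => x i) '' tsupport F)
            (hc.isCompact.image (continuous_apply i)) ?_
          intro r hr
          exact ⟨i.insertNth r y, subset_tsupport _ hr, by simp⟩
        refine (lintegral_mul_sq_le_fderiv w hw (hF.comp (hsl y)) hcs).trans (le_of_eq ?_)
        congr 1
        refine Finset.sum_congr rfl fun k _ => lintegral_congr fun r => ?_
        have := ((hF.differentiable (by simp) _).hasFDerivAt.comp r (hder y r)).fderiv
        rw [show (F ∘ fun r : E3 => (i.insertNth r y : Config (n+1))) =
          fun r => F (i.insertNth r y) from rfl] at this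
        rw [Function.comp_def, this]
        rfl
    _ ≤ sobolevConst * eLpNorm w (3 / 2) volume * ∫⁻ y : Config n,
          ∑ k, ∫⁻ r, ‖fderiv ℝ F (i.insertNth r y) (coordDir i k)‖ₑ ^ 2 := by
        rw [lintegral_const_mul]
        refine Finset.measurable_sum _ fun k _ => ?_
        refine Measurable.lintegral_prod_right' (f := fun p : Config n × E3 =>
          ‖fderiv ℝ F (i.insertNth p.2 p.1) (coordDir i k)‖ₑ ^ 2) ?_
        refine (hD k).comp ?_
        exact (MeasurableEquiv.piFinSuccAbove (fun _ : Fin (n + 1) => E3) i).symm.measurable.comp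
          measurable_swap
    _ = _ := by
        rw [lintegral_finsetSum]
        · congr 1
          exact Finset.sum_congr rfl fun k _ => lintegral_insertNth i (hD k).aemeasurable
        · intro k _
          refine Measurable.lintegral_prod_right' (f := fun p : Config n × E3 =>
            ‖fderiv ℝ F (i.insertNth p.2 p.1) (coordDir i k)‖ₑ ^ 2) ?_
          refine (hD k).comp ?_
          exact (MeasurableEquiv.piFinSuccAbove (fun _ : Fin (n + 1) => E3) i).symm.measurable.comp
            measurable_swap

/-! ### Mollification on configuration space -/

section Mollification

variable {N : ℕ}

instance isNegInvariant_volume_config : (volume : Measure (Config N)).IsNegInvariant :=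
  Measure.pi.isNegInvariant _

/-- The mollification of `f` by the normalised bump function `b`. -/
noncomputable def mollify (b : ContDiffBump (0 : Config N)) (f : Config N → ℂ) : Config N → ℂ :=
  convolution (b.normed volume) f (ContinuousLinearMap.lsmul ℝ ℝ) volume

lemma mollify_eq (b : ContDiffBump (0 : Config N)) (f : Config N → ℂ) (x : Config N) :
    mollify b f x = ∫ t, ((b.normed volume (x - t) : ℝ) : ℂ) * f t := by
  rw [mollify, convolution_eq_swap]
  simp

lemma mollify_eq' (b : ContDiffBump (0 : Config N)) (f : Config N → ℂ) (x : Config N) :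
    mollify b f x = ∫ t, b.normed volume t • f (x - t) := rfl

lemma contDiff_mollify (b : ContDiffBump (0 : Config N)) {f : Config N → ℂ}
    (hf : LocallyIntegrable f) : ContDiff ℝ 1 (mollify b f) :=
  b.hasCompactSupport_normed.contDiff_convolution_left (n := 1) _ b.contDiff_normed hf

/-- The weak derivative is tested against `t ↦ b(x - t)`. Differentiating in `t` instead of `x`
produces a sign, which cancels the one from integration by parts. -/
lemma fderiv_mollify (b : ContDiffBump (0 : Config N)) {f g : Config N → ℂ} {e : Config N}
    (hf : LocallyIntegrable f) (h : HasWeakDeriv f g e) (x : Config N) :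
    fderiv ℝ (mollify b f) x e = mollify b g x := by
  have hb : ContDiff ℝ ∞ (b.normed volume) := b.contDiff_normed
  have hb1 : ContDiff ℝ 1 (b.normed volume) := b.contDiff_normed (n := 1)
  have hd := b.hasCompactSupport_normed.hasFDerivAt_convolution_right
    (ContinuousLinearMap.lsmul ℝ ℝ (E := ℂ)).flip hf hb1 x
  rw [convolution_flip] at hd
  rw [mollify, hd.fderiv, convolution_precompR_apply _ hf
    (b.hasCompactSupport_normed.fderiv ℝ) (hb1.continuous_fderiv (by simp))]
  rw [mollify_eq, convolution_def]
  have hφ : ContDiff ℝ ∞ fun t => b.normed volume (x - t) := hb.comp (contDiff_const.sub contDiff_id)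
  have hφc : HasCompactSupport fun t => b.normed volume (x - t) := by
    have := b.hasCompactSupport_normed (μ := volume)
    exact this.comp_homeomorph (Homeomorph.subLeft x)
  have hder : ∀ t, fderiv ℝ (fun t => b.normed volume (x - t)) t e =
      - fderiv ℝ (b.normed volume) (x - t) e := by
    intro t
    have h1 := (hb1.differentiable (by simp) (x - t)).hasFDerivAt
    have h2 : HasFDerivAt (fun t : Config N => x - t) (-ContinuousLinearMap.id ℝ _) t :=
      (hasFDerivAt_id t).const_sub x
    have := (h1.comp t h2).fderiv
    rw [Function.comp_def] at this
    rw [this]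
    simp
  have := h _ hφ hφc
  simp only [hder] at this
  rw [neg_eq_iff_eq_neg.symm, ← integral_neg] at this
  rw [← this]
  refine integral_congr_ae (Eventually.of_forall fun t => ?_)
  simp

lemma lintegral_normed (b : ContDiffBump (0 : Config N)) :
    ∫⁻ t, ‖b.normed volume t‖ₑ = 1 := by
  have h := b.integral_normed (μ := volume)
  have h2 := ofReal_integral_eq_lintegral_ofReal (b.integrable_normed (μ := volume))
    (Eventually.of_forall fun t => b.nonneg_normed t)
  rw [h, ENNReal.ofReal_one] at h2
  rw [h2]
  refine lintegral_congr fun t => ?_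
  rw [Real.enorm_of_nonneg (b.nonneg_normed t)]

lemma lintegral_mul_sq_le {α : Type*} [MeasurableSpace α] {μ : Measure α} {p h : α → ℝ≥0∞}
    (hp : AEMeasurable p μ) (hh : AEMeasurable h μ) :
    (∫⁻ t, p t * h t ∂μ) ^ 2 ≤ (∫⁻ t, p t ∂μ) * ∫⁻ t, p t * h t ^ 2 ∂μ := by
  have hpq : (2 : ℝ).HolderConjugate 2 := by
    rw [Real.holderConjugate_iff]; norm_num
  have key := ENNReal.lintegral_mul_le_Lp_mul_Lq μ hpq (f := fun t => p t ^ (1 / 2 : ℝ))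
    (g := fun t => p t ^ (1 / 2 : ℝ) * h t) (hp.pow_const _) ((hp.pow_const _).mul hh)
  have hsq : ∀ a : ℝ≥0∞, a ^ (1 / 2 : ℝ) * a ^ (1 / 2 : ℝ) = a := fun a => by
    rw [← ENNReal.rpow_add_of_nonneg _ _ (by norm_num) (by norm_num)]; norm_num
  have hsq' : ∀ a : ℝ≥0∞, (a ^ (1 / 2 : ℝ)) ^ 2 = a := fun a => by rw [sq, hsq]
  simp only [Pi.mul_apply, ← mul_assoc, hsq, ENNReal.rpow_ofNat, mul_pow, hsq'] at key
  calc _ ≤ ((∫⁻ t, p t ∂μ) ^ (1 / 2 : ℝ) * (∫⁻ t, p t * h t ^ 2 ∂μ) ^ (1 / 2 : ℝ)) ^ 2 := by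
        gcongr
    _ = _ := by rw [mul_pow, hsq', hsq']

/-- Cauchy–Schwarz against the probability density `b.normed` bounds the square of the average by
the average of the squares; Tonelli and translation invariance then finish. -/
lemma lintegral_mollify_sq_le (b : ContDiffBump (0 : Config N)) {f : Config N → ℂ}
    (hf : AEStronglyMeasurable f) :
    ∫⁻ x, ‖mollify b f x‖ₑ ^ 2 ≤ ∫⁻ x, ‖f x‖ₑ ^ 2 := by
  have hbm : Measurable fun t => ‖b.normed volume t‖ₑ := b.continuous_normed.measurable.enorm
  calc ∫⁻ x, ‖mollify b f x‖ₑ ^ 2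
      ≤ ∫⁻ x, ∫⁻ t, ‖b.normed volume t‖ₑ * ‖f (x - t)‖ₑ ^ 2 := by
        refine lintegral_mono fun x => ?_
        have h1 : ‖mollify b f x‖ₑ ≤ ∫⁻ t, ‖b.normed volume t‖ₑ * ‖f (x - t)‖ₑ := by
          rw [mollify_eq']
          refine (enorm_integral_le_lintegral_enorm _).trans (le_of_eq ?_)
          simp only [enorm_smul]
        have h2 : AEMeasurable fun t => ‖f (x - t)‖ₑ :=
          (hf.comp_quasiMeasurePreserving
            (quasiMeasurePreserving_sub_left_of_right_invariant volume x)).enorm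
        have h3 := lintegral_mul_sq_le hbm.aemeasurable h2
        rw [lintegral_normed, one_mul] at h3
        exact (pow_le_pow_left' h1 2).trans h3
    _ = ∫⁻ t, ∫⁻ x, ‖b.normed volume t‖ₑ * ‖f (x - t)‖ₑ ^ 2 := by
        rw [lintegral_lintegral_swap]
        have h4 : AEMeasurable (fun p : Config N × Config N => ‖f (p.1 - p.2)‖ₑ)
            (volume.prod volume) :=
          (hf.comp_quasiMeasurePreserving
            (quasiMeasurePreserving_sub_of_right_invariant volume volume)).enorm
        exact (hbm.comp measurable_snd).aemeasurable.mul (h4.pow_const 2)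
    _ = ∫⁻ t, ‖b.normed volume t‖ₑ * ∫⁻ x, ‖f x‖ₑ ^ 2 := by
        refine lintegral_congr fun t => ?_
        rw [lintegral_const_mul' _ _ enorm_ne_top,
          lintegral_sub_right_eq_self (fun x => ‖f x‖ₑ ^ 2) t]
    _ = _ := by rw [lintegral_mul_const _ hbm, lintegral_normed, one_mul]

end Mollification

/-! ### Extension of the Sobolev estimate to weak gradients in `L²` -/

variable {n : ℕ}

lemma enorm_add_sq_le {E : Type*} [NormedAddCommGroup E] (a b : E) :
    ‖a + b‖ₑ ^ 2 ≤ 2 * ‖a‖ₑ ^ 2 + 2 * ‖b‖ₑ ^ 2 := by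
  have h := ENNReal.rpow_add_le_mul_rpow_add_rpow ‖a‖ₑ ‖b‖ₑ (p := 2) (by norm_num)
  norm_num at h
  rw [← mul_add]
  exact (pow_le_pow_left' (enorm_add_le _ _) 2).trans h

/-- There are cutoff functions tending to `1` with uniformly bounded derivatives. -/
lemma exists_cutoff (N : ℕ) : ∃ M : ℝ≥0, ∃ η : ℕ → Config N → ℝ,
    (∀ m, ContDiff ℝ 1 (η m)) ∧ (∀ m, HasCompactSupport (η m)) ∧ (∀ m x, ‖η m x‖ ≤ 1) ∧
    (∀ m x, ‖fderiv ℝ (η m) x‖ ≤ M) ∧ ∀ x, Tendsto (fun m => η m x) atTop (𝓝 1) := by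
  let b : ContDiffBump (0 : Config N) := ⟨1, 2, by norm_num, by norm_num⟩
  have hb1 : ContDiff ℝ 1 b := b.contDiff
  obtain ⟨M, hM⟩ := (hb1.continuous_fderiv (by simp)).bounded_above_of_compact_support
    (b.hasCompactSupport.fderiv ℝ)
  have hM0 : 0 ≤ M := (norm_nonneg _).trans (hM 0)
  -- The cutoffs are dilations of one fixed bump. The factor `c m ≤ 1` from the chain rule keeps
  -- their derivatives below that of the bump.
  let c : ℕ → ℝ := fun m => ((m : ℝ) + 1)⁻¹
  have hc0 : ∀ m, 0 < c m := fun m => by positivity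
  have hc1 : ∀ m, c m ≤ 1 := fun m => inv_le_one_of_one_le₀ (by simp)
  refine ⟨⟨M, hM0⟩, fun m x => b (c m • x), fun m => hb1.comp (contDiff_const_smul _),
    fun m => ?_, fun m x => ?_, fun m x => ?_, fun x => ?_⟩
  · exact b.hasCompactSupport.comp_homeomorph (Homeomorph.smulOfNeZero (c m) (hc0 m).ne')
  · rw [Real.norm_of_nonneg b.nonneg]; exact b.le_one
  · have h1 := (hb1.differentiable (by simp) (c m • x)).hasFDerivAt
    have h2 : HasFDerivAt (fun x : Config N => c m • x) (c m • ContinuousLinearMap.id ℝ _) x :=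
      (hasFDerivAt_id x).const_smul (c m)
    have h3 := (h1.comp x h2).fderiv
    rw [Function.comp_def] at h3
    rw [h3, ContinuousLinearMap.comp_smul, ContinuousLinearMap.comp_id, norm_smul,
      Real.norm_of_nonneg (hc0 m).le]
    calc c m * ‖fderiv ℝ b (c m • x)‖ ≤ 1 * M := by
          gcongr
          exacts [hc1 m, hM _]
      _ = M := one_mul M
  · have h0 : Tendsto (fun m => c m • x) atTop (𝓝 0) := by
      have : Tendsto c atTop (𝓝 0) := by
        simpa [c, one_div] using tendsto_one_div_add_atTop_nhds_zero_nat (𝕜 := ℝ)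
      simpa using this.smul_const x
    have h1 := (b.continuous.tendsto 0).comp h0
    rwa [b.one_of_mem_closedBall (by simp [b])] at h1

lemma norm_coordDir_le {N : ℕ} (i : Fin N) (k : Fin 3) : ‖(coordDir i k : Config N)‖ ≤ 1 := by
  simp [coordDir, Pi.norm_single]

/-- The Sobolev inequality in the coordinate of one particle, in the form of an estimate for a
multiplication operator. -/
theorem exists_lintegral_coord_mul_sq_le (n : ℕ) : ∃ C : ℝ≥0, ∀ (i : Fin (n + 1)) (w : E3 → ℝ),
    AEStronglyMeasurable w → ∀ (f : Config (n + 1) → ℂ) (g : Fin 3 → Config (n + 1) → ℂ),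
    MemLp f 2 volume → (∀ k, MemLp (g k) 2 volume) →
    (∀ k, HasWeakDeriv f (g k) (coordDir i k)) →
    ∫⁻ x, ‖w (x i)‖ₑ * ‖f x‖ₑ ^ 2 ≤ C * eLpNorm w (3 / 2) volume *
      ((∑ k, ∫⁻ x, ‖g k x‖ₑ ^ 2) + ∫⁻ x, ‖f x‖ₑ ^ 2) := by
  obtain ⟨M, η, hη, hηc, hη1, hηM, hηt⟩ := exists_cutoff (n + 1)
  -- With `f` replaced by cutoff times mollification, the product rule and `|a + b|² ≤ 2|a|² +
  -- 2|b|²` give `2 ‖g k‖² + 2 M² ‖f‖²` for each of the three directions. The cutoff term is the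
  -- reason for `‖f‖²` on the right-hand side.
  refine ⟨sobolevConst * (2 + 6 * M ^ 2), fun i w hw f g hf hg hfg => ?_⟩
  let b : ℕ → ContDiffBump (0 : Config (n + 1)) := fun m =>
    ⟨((m : ℝ) + 1)⁻¹, 2 * ((m : ℝ) + 1)⁻¹, by positivity, by
      have : (0 : ℝ) < ((m : ℝ) + 1)⁻¹ := by positivity
      linarith⟩
  have hfl : LocallyIntegrable f := hf.locallyIntegrable (by norm_num)
  have hlim : ∀ᵐ x, Tendsto (fun m => mollify (b m) f x) atTop (𝓝 (f x)) := by
    refine ContDiffBump.ae_convolution_tendsto_right_of_locallyIntegrable (K := 2) ?_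
      (Eventually.of_forall fun m => le_rfl) hfl
    have := (tendsto_one_div_add_atTop_nhds_zero_nat (𝕜 := ℝ)).const_mul 2
    simpa [b, one_div] using this
  let H : ℕ → Config (n + 1) → ℂ := fun m x => η m x • mollify (b m) f x
  have hH : ∀ m, ContDiff ℝ 1 (H m) := fun m => (hη m).smul (contDiff_mollify (b m) hfl)
  have hHc : ∀ m, HasCompactSupport (H m) := fun m => (hηc m).smul_right
  have hHlim : ∀ᵐ x, Tendsto (fun m => H m x) atTop (𝓝 (f x)) := by
    filter_upwards [hlim] with x hx
    have h := (hηt x).smul hx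
    rwa [one_smul] at h
  have hHder : ∀ m k x, ‖fderiv ℝ (H m) x (coordDir i k)‖ₑ ^ 2 ≤
      2 * ‖mollify (b m) (g k) x‖ₑ ^ 2 + 2 * (M ^ 2 * ‖mollify (b m) f x‖ₑ ^ 2) := by
    intro m k x
    have h1 := ((hη m).differentiable (by simp) x).hasFDerivAt.smul
      ((contDiff_mollify (b m) hfl).differentiable (by simp) x).hasFDerivAt
    have h2 : fderiv ℝ (H m) x (coordDir i k) = η m x • mollify (b m) (g k) x +
        (fderiv ℝ (η m) x (coordDir i k)) • mollify (b m) f x := by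
      have h3 : fderiv ℝ (H m) x = _ := h1.fderiv
      rw [h3, ← fderiv_mollify (b m) hfl (hfg k) x]
      simp
    rw [h2]
    refine (enorm_add_sq_le _ _).trans ?_
    have h4 : ‖η m x‖ₑ ≤ 1 := by
      rw [← ofReal_norm, ENNReal.ofReal_le_one]; exact hη1 m x
    have h5 : ‖fderiv ℝ (η m) x (coordDir i k)‖ₑ ≤ M := by
      rw [← ofReal_norm, ← ENNReal.ofReal_coe_nnreal]
      refine ENNReal.ofReal_le_ofReal (((fderiv ℝ (η m) x).le_opNorm _).trans ?_)
      calc _ ≤ (M : ℝ) * 1 := by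
            gcongr
            exacts [hηM m x, norm_coordDir_le i k]
        _ = M := mul_one _
    rw [enorm_smul, enorm_smul, mul_pow, mul_pow]
    gcongr
    calc _ ≤ 1 ^ 2 * ‖mollify (b m) (g k) x‖ₑ ^ 2 := by gcongr
      _ = _ := by simp
  have hmm : ∀ (m : ℕ) {f : Config (n + 1) → ℂ}, MemLp f 2 volume →
      Measurable fun x => ‖mollify (b m) f x‖ₑ ^ 2 := fun m f hf =>
    (contDiff_mollify (b m) (hf.locallyIntegrable (by norm_num))).continuous.measurable.enorm.pow_const 2
  have hbound : ∀ m, ∫⁻ x, ‖w (x i)‖ₑ * ‖H m x‖ₑ ^ 2 ≤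
      ((sobolevConst * (2 + 6 * M ^ 2) : ℝ≥0) : ℝ≥0∞) * eLpNorm w (3 / 2) volume *
      ((∑ k, ∫⁻ x, ‖g k x‖ₑ ^ 2) + ∫⁻ x, ‖f x‖ₑ ^ 2) := by
    intro m
    refine (lintegral_coord_mul_sq_le_fderiv i w hw (hH m) (hHc m)).trans ?_
    have hk : ∀ k, ∫⁻ x, ‖fderiv ℝ (H m) x (coordDir i k)‖ₑ ^ 2 ≤
        2 * (∫⁻ x, ‖g k x‖ₑ ^ 2) + 2 * (M ^ 2 * ∫⁻ x, ‖f x‖ₑ ^ 2) := by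
      intro k
      refine (lintegral_mono (hHder m k)).trans ?_
      rw [lintegral_add_left ((hmm m (hg k)).const_mul 2), lintegral_const_mul _ (hmm m (hg k)),
        lintegral_const_mul _ ((hmm m hf).const_mul _), lintegral_const_mul _ (hmm m hf)]
      have h6 := lintegral_mollify_sq_le (b m) (hg k).1
      have h7 := lintegral_mollify_sq_le (b m) hf.1
      exact add_le_add (mul_le_mul_right h6 _) (mul_le_mul_right (mul_le_mul_right h7 _) _)
    calc _ ≤ sobolevConst * eLpNorm w (3 / 2) volume *
          ∑ k, (2 * (∫⁻ x, ‖g k x‖ₑ ^ 2) + 2 * (M ^ 2 * ∫⁻ x, ‖f x‖ₑ ^ 2)) := by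
          gcongr with k
          exact hk k
      _ = sobolevConst * eLpNorm w (3 / 2) volume *
          (2 * (∑ k, ∫⁻ x, ‖g k x‖ₑ ^ 2) + 6 * M ^ 2 * ∫⁻ x, ‖f x‖ₑ ^ 2) := by
          congr 1
          simp only [Fin.sum_univ_three]
          ring
      _ ≤ sobolevConst * eLpNorm w (3 / 2) volume *
          ((2 + 6 * M ^ 2) * (∑ k, ∫⁻ x, ‖g k x‖ₑ ^ 2) +
            (2 + 6 * M ^ 2) * ∫⁻ x, ‖f x‖ₑ ^ 2) := by
          gcongr
          · exact le_self_add
          · exact le_add_self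
      _ = _ := by push_cast; ring
  have hwi : AEMeasurable fun x : Config (n + 1) => ‖w (x i)‖ₑ :=
    hw.enorm.comp_quasiMeasurePreserving (quasiMeasurePreserving_coord i)
  -- Fatou's lemma: the approximants converge almost everywhere and their bounds do not depend on
  -- `m`, so convergence in norm is not needed.
  calc ∫⁻ x, ‖w (x i)‖ₑ * ‖f x‖ₑ ^ 2
      = ∫⁻ x, liminf (fun m => ‖w (x i)‖ₑ * ‖H m x‖ₑ ^ 2) atTop := by
        refine lintegral_congr_ae ?_
        filter_upwards [hHlim] with x hx
        refine (Tendsto.liminf_eq ?_).symm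
        exact ENNReal.Tendsto.const_mul ((ENNReal.continuous_pow 2).continuousAt.tendsto.comp
          ((continuous_enorm.tendsto _).comp hx)) (Or.inr enorm_ne_top)
    _ ≤ liminf (fun m => ∫⁻ x, ‖w (x i)‖ₑ * ‖H m x‖ₑ ^ 2) atTop :=
        lintegral_liminf_le' fun m => hwi.mul
          ((hH m).continuous.measurable.enorm.pow_const 2).aemeasurable
    _ ≤ _ := liminf_le_of_le (by isBoundedDefault) fun a ha => by
        obtain ⟨m, hm⟩ := ha.exists
        exact hm.trans (hbound m)

/-! ### The classes `L^p + L^∞` and the square of the vector potential -/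

section LpSum

variable {F : Type*} [NormedAddCommGroup F]

lemma three_halves_ne_top : (3 / 2 : ℝ≥0∞) ≠ ⊤ := by simp [ENNReal.div_eq_top]

lemma lpSpace_subset_lpSum (p : ℝ≥0∞) : lpSpace F p ⊆ lpSum F p ⊤ :=
  fun f hf => ⟨f, hf, 0, MemLp.zero, by simp⟩

lemma aestronglyMeasurable_of_mem_lpSum {p q : ℝ≥0∞} {f : E3 → F} (hf : f ∈ lpSum F p q) :
    AEStronglyMeasurable f := by
  obtain ⟨g, hg, h, hh, rfl⟩ := hf
  exact hg.1.add hh.1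

lemma add_mem_lpSpace {p : ℝ≥0∞} {f g : E3 → F} (hf : f ∈ lpSpace F p) (hg : g ∈ lpSpace F p) :
    f + g ∈ lpSpace F p := MemLp.add hf hg

lemma sub_mem_lpSpace {p : ℝ≥0∞} {f g : E3 → F} (hf : f ∈ lpSpace F p) (hg : g ∈ lpSpace F p) :
    f - g ∈ lpSpace F p := MemLp.sub hf hg

lemma add_mem_lpSum {p q : ℝ≥0∞} {f g : E3 → F} (hf : f ∈ lpSum F p q) (hg : g ∈ lpSum F p q) :
    f + g ∈ lpSum F p q := by
  obtain ⟨a, ha, b, hb, rfl⟩ := hf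
  obtain ⟨c, hc, d, hd, rfl⟩ := hg
  exact ⟨a + c, add_mem_lpSpace ha hc, b + d, add_mem_lpSpace hb hd, by abel⟩

lemma sub_mem_lpSum {p q : ℝ≥0∞} {f g : E3 → F} (hf : f ∈ lpSum F p q) (hg : g ∈ lpSum F p q) :
    f - g ∈ lpSum F p q := by
  obtain ⟨a, ha, b, hb, rfl⟩ := hf
  obtain ⟨c, hc, d, hd, rfl⟩ := hg
  exact ⟨a - c, sub_mem_lpSpace ha hc, b - d, sub_mem_lpSpace hb hd, by abel⟩

/-- Truncating `f` at height `M` gives the bounded part; the remainder has absolute value at most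
`|a|`. This is needed for `|g + h|²`, whose cross term prevents a direct splitting. -/
lemma mem_lpSum_of_abs_le {p : ℝ≥0∞} {f a : E3 → ℝ} {M : ℝ} (hM : 0 ≤ M)
    (hf : AEStronglyMeasurable f) (ha : MemLp a p volume) (h : ∀ᵐ r, |f r| ≤ |a r| + M) :
    f ∈ lpSum ℝ p ⊤ := by
  have hc : AEStronglyMeasurable fun r => max (-M) (min (f r) M) :=
    (by fun_prop : Continuous fun t : ℝ => max (-M) (min t M)).comp_aestronglyMeasurable hf
  refine ⟨fun r => f r - max (-M) (min (f r) M), ?_, fun r => max (-M) (min (f r) M), ?_, ?_⟩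
  · refine MemLp.of_le ha (hf.sub hc) ?_
    filter_upwards [h] with r hr
    rw [Real.norm_eq_abs, Real.norm_eq_abs]
    have ha0 := abs_nonneg (a r)
    rw [abs_le] at hr ⊢
    rcases max_cases (-M) (min (f r) M) with h1 | h1 <;>
      rcases min_cases (f r) M with h2 | h2 <;> constructor <;> linarith [h1.1, h2.1, h1.2, h2.2]
  · refine memLp_top_of_bound hc M (Eventually.of_forall fun r => ?_)
    rw [Real.norm_eq_abs, abs_le]
    exact ⟨le_max_left _ _, max_le (by linarith) (min_le_right _ _)⟩
  · funext r; simp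

lemma sq_norm_mem_lpSpace {A : E3 → E3} (hA : A ∈ lpSpace E3 3) :
    (fun r => ‖A r‖ ^ 2) ∈ lpSpace ℝ (3 / 2) := by
  have h := MemLp.norm_rpow_div (p := 3) hA 2
  simp only [ENNReal.toReal_ofNat, Real.rpow_ofNat] at h
  exact h

lemma half_sq_norm_mem_lpSpace {A : E3 → E3} (hA : A ∈ lpSpace E3 3) :
    (fun r => 1 / 2 * ‖A r‖ ^ 2) ∈ lpSpace ℝ (3 / 2) :=
  MemLp.const_mul (sq_norm_mem_lpSpace hA) _

lemma sq_norm_mem_lpSum {A : E3 → E3} (hA : A ∈ lpSum E3 3 ⊤) :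
    (fun r => ‖A r‖ ^ 2) ∈ lpSum ℝ (3 / 2) ⊤ := by
  have hm := aestronglyMeasurable_of_mem_lpSum hA
  obtain ⟨g, hg, h, hh, rfl⟩ := hA
  have hB : ∀ᵐ r, ‖h r‖ ≤ (eLpNorm h ⊤ volume).toReal := by
    rw [eLpNorm_exponent_top]
    filter_upwards [ae_le_eLpNormEssSup (f := h) (μ := volume)] with r hr
    have := ENNReal.toReal_mono (by simpa using hh.2.ne) hr
    simpa using this
  refine mem_lpSum_of_abs_le (M := 2 * (eLpNorm h ⊤ volume).toReal ^ 2) (by positivity)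
    (hm.norm.pow 2) (MemLp.const_mul (sq_norm_mem_lpSpace hg) 2) ?_
  filter_upwards [hB] with r hr
  rw [abs_of_nonneg (by positivity), abs_of_nonneg (by positivity)]
  have h1 : ‖(g + h) r‖ ≤ ‖g r‖ + ‖h r‖ := norm_add_le _ _
  have h2 : ‖(g + h) r‖ ^ 2 ≤ (‖g r‖ + ‖h r‖) ^ 2 := by gcongr
  have h3 : ‖h r‖ ^ 2 ≤ (eLpNorm h ⊤ volume).toReal ^ 2 := by gcongr
  nlinarith [sq_nonneg (‖g r‖ - ‖h r‖)]

lemma half_sq_norm_mem_lpSum {A : E3 → E3} (hA : A ∈ lpSum E3 3 ⊤) :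
    (fun r => 1 / 2 * ‖A r‖ ^ 2) ∈ lpSum ℝ (3 / 2) ⊤ := by
  obtain ⟨g, hg, h, hh, e⟩ := sq_norm_mem_lpSum hA
  refine ⟨fun r => 1 / 2 * g r, MemLp.const_mul hg _, fun r => 1 / 2 * h r,
    MemLp.const_mul hh _, ?_⟩
  funext r
  have := congrFun e r
  simp only [Pi.add_apply] at this ⊢
  rw [this, mul_add]

/-- A function of class `L^p + L^∞` is a bounded function up to an arbitrarily small `L^p` error. -/
lemma exists_small_add_bounded {p : ℝ≥0∞} (hp : p ≠ ⊤) {w : E3 → ℝ} (hw : w ∈ lpSum ℝ p ⊤)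
    {δ : ℝ≥0∞} (hδ : δ ≠ 0) : ∃ w₁ : E3 → ℝ, ∃ B : ℝ≥0, AEStronglyMeasurable w₁ ∧
      eLpNorm w₁ p volume ≤ δ ∧ ∀ᵐ r, ‖w r‖ₑ ≤ ‖w₁ r‖ₑ + B := by
  obtain ⟨g, hg, h, hh, rfl⟩ := hw
  -- Compactly supported continuous functions are dense in `L^p` for `p < ∞` and bounded, so `c` can
  -- be moved to the bounded part.
  obtain ⟨c, hc, hgc, hcc, hcp⟩ := MemLp.exists_hasCompactSupport_eLpNorm_sub_le hp hg hδ
  obtain ⟨M, hM⟩ := hcc.bounded_above_of_compact_support hc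
  refine ⟨g - c, M.toNNReal + (eLpNorm h ⊤ volume).toNNReal, hg.1.sub hcp.1, hgc, ?_⟩
  have hh' : eLpNorm h ⊤ volume ≠ ⊤ := hh.2.ne
  have h1 : ∀ᵐ r, ‖h r‖ₑ ≤ eLpNorm h ⊤ volume := by
    rw [eLpNorm_exponent_top]; exact ae_le_eLpNormEssSup
  filter_upwards [h1] with r hr
  have h2 : (g + h) r = (g - c) r + (c r + h r) := by
    simp only [Pi.add_apply, Pi.sub_apply]; ring
  rw [h2]
  refine (enorm_add_le _ _).trans (add_le_add le_rfl ((enorm_add_le _ _).trans ?_))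
  push_cast
  rw [ENNReal.coe_toNNReal hh']
  refine add_le_add ?_ hr
  rw [← ofReal_norm]
  exact ENNReal.ofReal_le_ofReal (hM r)

end LpSum

/-! ### Relative form bounds with respect to the kinetic energy -/

section FormBounds

variable {n : ℕ} {σ : Type*} [Fintype σ] {V : Submodule ℂ (SpinConfig σ (n + 1) → ℂ)}

/-- The quadratic form `⟨ψ, ∑ₖ w(rₖ) ψ⟩` of a nonnegative multiplication operator. -/
noncomputable def potentialForm {N : ℕ} {V : Submodule ℂ (SpinConfig σ N → ℂ)}
    (w : E3 → ℝ≥0∞) (ψ : Wavefunction N σ V) : ℝ≥0∞ :=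
  ∑ s, ∫⁻ x, (∑ k, w (x k)) * ‖ψ.toFun x s‖ₑ ^ 2

lemma positivePotential_eq (v : E3 → ℝ) (ψ : Wavefunction (n + 1) σ V) :
    positivePotential v ψ = potentialForm (fun r => ENNReal.ofReal (v r)) ψ := rfl

lemma aemeasurable_sq_enorm (ψ : Wavefunction (n + 1) σ V) (s : SpinConfig σ (n + 1)) :
    AEMeasurable fun x => ‖ψ.toFun x s‖ₑ ^ 2 := (ψ.memLp s).1.enorm.pow_const 2

lemma aemeasurable_coord {α : Type*} [MeasurableSpace α] {w : E3 → α} (hw : AEMeasurable w)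
    (i : Fin (n + 1)) : AEMeasurable fun x : Config (n + 1) => w (x i) :=
  hw.comp_quasiMeasurePreserving (quasiMeasurePreserving_coord i)

lemma potentialForm_eq_sum {w : E3 → ℝ≥0∞} (hw : AEMeasurable w) (ψ : Wavefunction (n + 1) σ V) :
    potentialForm w ψ = ∑ s, ∑ i, ∫⁻ x, w (x i) * ‖ψ.toFun x s‖ₑ ^ 2 := by
  refine Finset.sum_congr rfl fun s _ => ?_
  simp only [Finset.sum_mul]
  exact lintegral_finsetSum' _ fun i _ => (aemeasurable_coord hw i).mul (aemeasurable_sq_enorm ψ s)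

lemma potentialForm_mono {w w' : E3 → ℝ≥0∞} (h : ∀ r, w r ≤ w' r)
    (ψ : Wavefunction (n + 1) σ V) : potentialForm w ψ ≤ potentialForm w' ψ := by
  unfold potentialForm
  gcongr
  exact h _

lemma enorm_I : ‖Complex.I‖ₑ = 1 := by rw [← ofReal_norm, Complex.norm_I, ENNReal.ofReal_one]

lemma kinetic_zero_eq (ψ : Wavefunction (n + 1) σ V) :
    kinetic 0 ψ = 2⁻¹ * ∑ i, ∑ k, ∑ s, ∫⁻ x, ‖ψ.grad i k x s‖ₑ ^ 2 := by
  simp [kinetic, enorm_mul, enorm_I]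

lemma two_mul_kinetic_zero_eq (ψ : Wavefunction (n + 1) σ V) :
    2 * kinetic 0 ψ = ∑ i, ∑ k, ∑ s, ∫⁻ x, ‖ψ.grad i k x s‖ₑ ^ 2 := by
  rw [kinetic_zero_eq, ← mul_assoc, ENNReal.mul_inv_cancel (by simp) (by simp), one_mul]

lemma lintegral_sq_enorm_ne_top {α : Type*} [MeasurableSpace α] {μ : Measure α} {f : α → ℂ}
    (hf : MemLp f 2 μ) : ∫⁻ x, ‖f x‖ₑ ^ 2 ∂μ ≠ ⊤ := by
  have := (lintegral_rpow_enorm_lt_top_of_eLpNorm_lt_top (by simp) (by simp) hf.2).ne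
  simpa using this

lemma kinetic_zero_ne_top (ψ : Wavefunction (n + 1) σ V) : kinetic 0 ψ ≠ ⊤ := by
  rw [kinetic_zero_eq]
  refine ENNReal.mul_ne_top (by simp) ?_
  simp only [ENNReal.sum_ne_top]
  exact fun i _ k _ s _ => lintegral_sq_enorm_ne_top (ψ.grad_memLp i k s)

/-- Potentials of class `L^{3/2} + L^∞` are infinitesimally form-bounded with respect to the
kinetic energy. -/
theorem exists_potentialForm_le {w : E3 → ℝ} (hw : w ∈ lpSum ℝ (3 / 2) ⊤) {ε : ℝ≥0}
    (hε : ε ≠ 0) : ∃ C : ℝ≥0, ∀ ψ : Wavefunction (n + 1) σ V,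
      potentialForm (fun r => ‖w r‖ₑ) ψ ≤ ε * kinetic 0 ψ + C := by
  obtain ⟨S, hS⟩ := exists_lintegral_coord_mul_sq_le n
  -- The 2 compensates the ½ in the kinetic energy, as the squared gradient norms add up to `2
  -- T(0)`; `S + 1` avoids division by zero.
  let δ : ℝ≥0 := ε / (2 * (S + 1))
  have hδ : δ ≠ 0 := by positivity
  have hSδ : S * δ * 2 ≤ ε := by
    have : (S + 1) * δ * 2 = ε := by
      simp only [δ]; field_simp
    calc S * δ * 2 ≤ (S + 1) * δ * 2 := by gcongr; exact le_self_add
      _ = ε := this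
  obtain ⟨w₁, B, hw₁, hw₁δ, hB⟩ := exists_small_add_bounded three_halves_ne_top hw
    (δ := δ) (by exact_mod_cast hδ)
  refine ⟨(n + 1) * (S * δ + B), fun ψ => ?_⟩
  have hwm := (aestronglyMeasurable_of_mem_lpSum hw).enorm
  have hone : ∀ s i, ∫⁻ x, ‖w (x i)‖ₑ * ‖ψ.toFun x s‖ₑ ^ 2 ≤
      S * δ * (∑ k, ∫⁻ x, ‖ψ.grad i k x s‖ₑ ^ 2) + (S * δ + B) * ∫⁻ x, ‖ψ.toFun x s‖ₑ ^ 2 := by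
    intro s i
    have h1 : ∫⁻ x, ‖w (x i)‖ₑ * ‖ψ.toFun x s‖ₑ ^ 2 ≤
        ∫⁻ x, (‖w₁ (x i)‖ₑ * ‖ψ.toFun x s‖ₑ ^ 2 + B * ‖ψ.toFun x s‖ₑ ^ 2) := by
      refine lintegral_mono_ae ?_
      filter_upwards [(quasiMeasurePreserving_coord i).ae hB] with x hx
      rw [← add_mul]
      gcongr
    refine h1.trans ?_
    have h2 : AEMeasurable fun x : Config (n + 1) => ‖w₁ (x i)‖ₑ * ‖ψ.toFun x s‖ₑ ^ 2 :=
      (aemeasurable_coord hw₁.enorm i).mul (aemeasurable_sq_enorm ψ s)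
    rw [lintegral_add_left' h2,
      lintegral_const_mul' _ _ (by simp), add_mul, ← add_assoc]
    refine add_le_add ?_ le_rfl
    refine (hS i w₁ hw₁ _ (fun k x => ψ.grad i k x s) (ψ.memLp s) (fun k => ψ.grad_memLp i k s)
      (fun k => ψ.hasWeakDeriv i k s)).trans ?_
    rw [← mul_add]
    exact mul_le_mul_left (mul_le_mul_right hw₁δ _) _
  rw [potentialForm_eq_sum hwm]
  calc _ ≤ ∑ s, ∑ i, (S * δ * (∑ k, ∫⁻ x, ‖ψ.grad i k x s‖ₑ ^ 2) +
          (S * δ + B) * ∫⁻ x, ‖ψ.toFun x s‖ₑ ^ 2) := by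
        gcongr with s _ i _; exact hone s i
    _ = S * δ * (2 * kinetic 0 ψ) + (n + 1) * (S * δ + B) := by
        simp only [Finset.sum_add_distrib, ← Finset.mul_sum, Finset.sum_const, Finset.card_univ,
          Fintype.card_fin, nsmul_eq_mul]
        rw [ψ.normalized, two_mul_kinetic_zero_eq]
        congr 1
        · congr 1
          rw [Finset.sum_comm]
          exact Finset.sum_congr rfl fun i _ => Finset.sum_comm
        · push_cast; ring
    _ ≤ _ := by
        push_cast
        refine add_le_add ?_ le_rfl
        rw [← mul_assoc]
        refine mul_le_mul_left ?_ _
        exact_mod_cast hSδ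

lemma potentialForm_ne_top {w : E3 → ℝ} (hw : w ∈ lpSum ℝ (3 / 2) ⊤)
    (ψ : Wavefunction (n + 1) σ V) : potentialForm (fun r => ‖w r‖ₑ) ψ ≠ ⊤ := by
  obtain ⟨C, hC⟩ := exists_potentialForm_le (σ := σ) (V := V) hw (ε := 1) one_ne_zero
  refine ne_top_of_le_ne_top ?_ (hC ψ)
  simp [kinetic_zero_ne_top]

lemma sum_enorm_sq_coord (a : E3) : ∑ k, ‖((a k : ℝ) : ℂ)‖ₑ ^ 2 = ‖‖a‖ ^ 2‖ₑ := by
  have h : ‖a‖₊ ^ 2 = ∑ k, ‖a k‖₊ ^ 2 := by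
    rw [← NNReal.coe_inj]; push_cast; exact EuclideanSpace.norm_sq_eq a
  rw [enorm_pow, enorm_norm, enorm_eq_nnnorm]
  norm_cast
  rw [h]
  push_cast
  refine Finset.sum_congr rfl fun k _ => ?_
  simp [enorm_eq_nnnorm]

/-- This turns the term quadratic in `A` into a scalar potential `|A|²`, to which the form bound
applies. -/
lemma sum_lintegral_coord_sq_eq {A : E3 → E3} (hA : AEStronglyMeasurable A)
    (ψ : Wavefunction (n + 1) σ V) :
    ∑ i, ∑ k, ∑ s, ∫⁻ x, ‖((A (x i) k : ℝ) : ℂ) * ψ.toFun x s‖ₑ ^ 2 =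
      potentialForm (fun r => ‖‖A r‖ ^ 2‖ₑ) ψ := by
  rw [potentialForm_eq_sum (by fun_prop), Finset.sum_comm' (s := Finset.univ) (t' := Finset.univ)
    (s' := fun _ => Finset.univ) (t := fun _ => Finset.univ) (by simp)]
  rw [Finset.sum_comm]
  rw [Finset.sum_comm (s := (Finset.univ : Finset (SpinConfig σ (n + 1))))]
  refine Finset.sum_congr rfl fun i _ => ?_
  rw [Finset.sum_comm]
  refine Finset.sum_congr rfl fun s _ => ?_
  have hk : ∀ k, AEMeasurable fun r => ‖((A r k : ℝ) : ℂ)‖ₑ ^ 2 := fun k => by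
    have : Continuous fun a : E3 => ((a k : ℝ) : ℂ) := by fun_prop
    exact (this.comp_aestronglyMeasurable hA).enorm.pow_const 2
  rw [← lintegral_finsetSum' _ fun k _ => by
    simp only [enorm_mul, mul_pow]
    exact (aemeasurable_coord (hk k) i).mul (aemeasurable_sq_enorm ψ s)]
  refine lintegral_congr fun x => ?_
  rw [← sum_enorm_sq_coord, Finset.sum_mul]
  simp only [enorm_mul, mul_pow]

/-- Write `-i∇ψ = (-i∇ + A)ψ - Aψ` and apply `|a + b|² ≤ 2|a|² + 2|b|²`. -/
lemma kinetic_zero_le_two_mul {A : E3 → E3} (hA : AEStronglyMeasurable A)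
    (ψ : Wavefunction (n + 1) σ V) :
    kinetic 0 ψ ≤ 2 * kinetic A ψ + potentialForm (fun r => ‖‖A r‖ ^ 2‖ₑ) ψ := by
  rw [kinetic_zero_eq, kinetic, ← sum_lintegral_coord_sq_eq hA]
  have h : ∀ i k s, ∫⁻ x, ‖ψ.grad i k x s‖ₑ ^ 2 ≤
      2 * (∫⁻ x, ‖-Complex.I * ψ.grad i k x s + ((A (x i) k : ℝ) : ℂ) * ψ.toFun x s‖ₑ ^ 2) +
      2 * ∫⁻ x, ‖((A (x i) k : ℝ) : ℂ) * ψ.toFun x s‖ₑ ^ 2 := by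
    intro i k s
    have hm : AEMeasurable fun x => ‖((A (x i) k : ℝ) : ℂ) * ψ.toFun x s‖ₑ ^ 2 := by
      have h1 : Continuous fun a : E3 => ((a k : ℝ) : ℂ) := by fun_prop
      have h2 := (h1.comp_aestronglyMeasurable hA).comp_quasiMeasurePreserving
        (quasiMeasurePreserving_coord i)
      exact (h2.mul (ψ.memLp s).1).enorm.pow_const 2
    rw [← lintegral_const_mul' _ _ (by simp), ← lintegral_const_mul' _ _ (by simp),
      ← lintegral_add_right' _ (hm.const_mul 2)]
    refine lintegral_mono fun x => ?_
    have h1 := enorm_add_sq_le (-Complex.I * ψ.grad i k x s + ((A (x i) k : ℝ) : ℂ) * ψ.toFun x s)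
      (-(((A (x i) k : ℝ) : ℂ) * ψ.toFun x s))
    rw [add_neg_cancel_right, enorm_neg, enorm_mul (-Complex.I), enorm_neg, enorm_I, one_mul] at h1
    exact h1
  calc _ ≤ 2⁻¹ * ∑ i, ∑ k, ∑ s,
      (2 * (∫⁻ x, ‖-Complex.I * ψ.grad i k x s + ((A (x i) k : ℝ) : ℂ) * ψ.toFun x s‖ₑ ^ 2) +
      2 * ∫⁻ x, ‖((A (x i) k : ℝ) : ℂ) * ψ.toFun x s‖ₑ ^ 2) := by
        gcongr with i _ k _ s _; exact h i k s
    _ = _ := by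
        simp only [Finset.sum_add_distrib, ← Finset.mul_sum]
        rw [mul_add, ← mul_assoc, ← mul_assoc, ← mul_assoc, mul_comm 2⁻¹ 2,
          ENNReal.mul_inv_cancel (by simp) (by simp), one_mul, one_mul]

/-- The kinetic energy is bounded by the magnetic kinetic energy. -/
theorem exists_kinetic_zero_le {A : E3 → E3} (hA : A ∈ lpSum E3 3 ⊤) :
    ∃ C : ℝ≥0, ∀ ψ : Wavefunction (n + 1) σ V, kinetic 0 ψ ≤ 4 * kinetic A ψ + C := by
  -- With relative bound ½ one gets `T(0) ≤ 2 T(A) + ½ T(0) + C`. Since `T(0)` is finite, its half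
  -- can be moved to the left.
  obtain ⟨C, hC⟩ := exists_potentialForm_le (σ := σ) (V := V) (n := n) (sq_norm_mem_lpSum hA)
    (ε := 2⁻¹) (by simp)
  refine ⟨2 * C, fun ψ => ?_⟩
  have h := (kinetic_zero_le_two_mul (aestronglyMeasurable_of_mem_lpSum hA) ψ).trans
    (add_le_add le_rfl (hC ψ))
  have hK := kinetic_zero_ne_top ψ
  rcases eq_or_ne (kinetic A ψ) ⊤ with hT | hT
  · rw [hT]; simp [ENNReal.mul_top]
  · lift kinetic 0 ψ to ℝ≥0 using hK with a
    lift kinetic A ψ to ℝ≥0 using hT with b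
    norm_cast at h ⊢
    rw [← NNReal.coe_le_coe] at h ⊢
    push_cast at h ⊢
    linarith

/-- The negative part of the potential energy is bounded by an arbitrarily small multiple of the
kinetic energy plus a constant. -/
theorem exists_positivePotential_neg_le {v : E3 → ℝ} (hv : v ∈ lpSum ℝ (3 / 2) ⊤) {ε : ℝ≥0}
    (hε : ε ≠ 0) : ∃ C : ℝ≥0, ∀ ψ : Wavefunction (n + 1) σ V,
      positivePotential (-v) ψ ≤ ε * kinetic 0 ψ + C := by
  obtain ⟨C, hC⟩ := exists_potentialForm_le (σ := σ) (V := V) (n := n) hv hε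
  refine ⟨C, fun ψ => ?_⟩
  rw [positivePotential_eq]
  have h : ∀ r, ENNReal.ofReal ((-v) r) ≤ ‖v r‖ₑ := fun r => by
    rw [← ofReal_norm, Pi.neg_apply, Real.norm_eq_abs]
    exact ENNReal.ofReal_le_ofReal (neg_le_abs _)
  exact (potentialForm_mono h ψ).trans (hC ψ)

end FormBounds

/-! ### Lower bounds for mixed states and for the constrained search -/

section LowerBounds

variable {n : ℕ} {σ : Type*} [Fintype σ] {V : Submodule ℂ (SpinConfig σ (n + 1) → ℂ)}

lemma aemeasurable_lintegral_cons {G : Config (n + 1) → ℝ≥0∞} (hG : AEMeasurable G) :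
    AEMeasurable fun r : E3 => ∫⁻ y : Config n, G (Fin.cons r y) := by
  have hmp := (volume_preserving_piFinSuccAbove (fun _ : Fin (n + 1) => E3) 0).symm
  have h := hG.comp_quasiMeasurePreserving hmp.quasiMeasurePreserving
  rw [Measure.volume_eq_prod] at h
  refine h.lintegral_prod_right'.congr (Eventually.of_forall fun r => ?_)
  refine lintegral_congr fun y => ?_
  rw [← Fin.insertNth_zero']
  rfl

lemma lintegral_mul_lintegral_cons {w : E3 → ℝ≥0∞} (hw : AEMeasurable w)
    {G : Config (n + 1) → ℝ≥0∞} (hG : AEMeasurable G) :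
    ∫⁻ r : E3, w r * ∫⁻ y : Config n, G (Fin.cons r y) = ∫⁻ x, w (x 0) * G x := by
  have hmp := (volume_preserving_piFinSuccAbove (fun _ : Fin (n + 1) => E3) 0).symm
  have h := hG.comp_quasiMeasurePreserving hmp.quasiMeasurePreserving
  rw [Measure.volume_eq_prod] at h
  have h0 : AEMeasurable fun x : Config (n + 1) => w (x 0) * G x :=
    (aemeasurable_coord hw 0).mul hG
  rw [← lintegral_insertNth' 0 h0]
  refine lintegral_congr_ae ?_
  -- Pulling the factor `w r` out of the inner integral, with `w r` possibly infinite, uses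
  -- measurability of the slice, available for almost every `r`.
  have h2 : ∀ᵐ r : E3, AEMeasurable fun y : Config n => G (Fin.insertNth 0 r y) := by
    obtain ⟨G', hG', hGG'⟩ := h
    filter_upwards [Measure.ae_ae_of_ae_prod hGG'] with r hr
    exact ⟨fun y => G' (r, y), hG'.comp (by fun_prop), hr⟩
  filter_upwards [h2] with r hr
  simp only [Fin.insertNth_apply_same]
  rw [lintegral_const_mul'' _ hr]
  simp only [Fin.insertNth_zero']

/-- A measurable bound of the density. -/
noncomputable def densityBound (ψ : Wavefunction (n + 1) σ V) (r : E3) : ℝ≥0∞ :=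
  (n + 1) * ∑ s, ∫⁻ y : Config n, ‖ψ.toFun (Fin.cons r y) s‖ₑ ^ 2

/-- A measurable bound of the current density. -/
noncomputable def currentBound (ψ : Wavefunction (n + 1) σ V) (r : E3) : ℝ≥0∞ :=
  (n + 1) * ∑ k, ∑ s, ∫⁻ y : Config n, ‖ψ.toFun (Fin.cons r y) s‖ₑ * ‖ψ.grad 0 k (Fin.cons r y) s‖ₑ

lemma aemeasurable_mul_grad (ψ : Wavefunction (n + 1) σ V) (k : Fin 3)
    (s : SpinConfig σ (n + 1)) :
    AEMeasurable fun x => ‖ψ.toFun x s‖ₑ * ‖ψ.grad 0 k x s‖ₑ :=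
  (ψ.memLp s).1.enorm.mul (ψ.grad_memLp 0 k s).1.enorm

lemma aemeasurable_densityBound (ψ : Wavefunction (n + 1) σ V) :
    AEMeasurable (densityBound ψ) :=
  (Finset.aemeasurable_fun_sum _ fun s _ =>
    aemeasurable_lintegral_cons (aemeasurable_sq_enorm ψ s)).const_mul _

lemma aemeasurable_currentBound (ψ : Wavefunction (n + 1) σ V) :
    AEMeasurable (currentBound ψ) :=
  (Finset.aemeasurable_fun_sum _ fun k _ => Finset.aemeasurable_fun_sum _ fun s _ =>
    aemeasurable_lintegral_cons (aemeasurable_mul_grad ψ k s)).const_mul _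

lemma enorm_natCast_add_one (n : ℕ) : ‖(n + 1 : ℝ)‖ₑ = n + 1 := by
  rw [← ofReal_norm, Real.norm_of_nonneg (by positivity)]
  exact_mod_cast ENNReal.ofReal_natCast (n + 1)

lemma enorm_density_le (ψ : Wavefunction (n + 1) σ V) (r : E3) :
    ‖density ψ r‖ₑ ≤ densityBound ψ r := by
  rw [density, densityBound, enorm_mul, enorm_natCast_add_one]
  gcongr
  refine (enorm_sum_le _ _).trans (Finset.sum_le_sum fun s _ => ?_)
  refine (enorm_integral_le_lintegral_enorm _).trans (le_of_eq ?_)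
  simp [enorm_pow]

lemma enorm_le_sum_enorm_coord (a : E3) : ‖a‖ₑ ≤ ∑ k, ‖a k‖ₑ := by
  have h : a = ∑ k, EuclideanSpace.single k (a k) := by
    ext i
    fin_cases i <;> simp [Fin.sum_univ_three]
  calc ‖a‖ₑ = ‖∑ k, EuclideanSpace.single k (a k)‖ₑ := by rw [← h]
    _ ≤ ∑ k, ‖EuclideanSpace.single k (a k)‖ₑ := enorm_sum_le _ _
    _ = _ := by simp [enorm_eq_nnnorm]

lemma enorm_im_le (z : ℂ) : ‖z.im‖ₑ ≤ ‖z‖ₑ := by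
  rw [← ofReal_norm, ← ofReal_norm]
  exact ENNReal.ofReal_le_ofReal (Complex.abs_im_le_norm z)

lemma enorm_current_le (ψ : Wavefunction (n + 1) σ V) (r : E3) :
    ‖current ψ r‖ₑ ≤ currentBound ψ r := by
  refine (enorm_le_sum_enorm_coord _).trans ?_
  rw [currentBound, Finset.mul_sum]
  refine Finset.sum_le_sum fun k _ => ?_
  simp only [current, enorm_mul, enorm_natCast_add_one]
  gcongr
  refine (enorm_im_le _).trans ((enorm_sum_le _ _).trans (Finset.sum_le_sum fun s _ => ?_))
  refine (enorm_integral_le_lintegral_enorm _).trans (le_of_eq ?_)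
  refine lintegral_congr fun y => ?_
  rw [enorm_mul, ← ofReal_norm, RCLike.norm_conj, ofReal_norm]

lemma lintegral_mul_densityBound {w : E3 → ℝ≥0∞} (hw : AEMeasurable w)
    (ψ : Wavefunction (n + 1) σ V) :
    ∫⁻ r, w r * densityBound ψ r = (n + 1) * ∑ s, ∫⁻ x, w (x 0) * ‖ψ.toFun x s‖ₑ ^ 2 := by
  simp only [densityBound, Finset.mul_sum]
  rw [lintegral_finsetSum']
  · refine Finset.sum_congr rfl fun s _ => ?_
    rw [← lintegral_mul_lintegral_cons hw (aemeasurable_sq_enorm ψ s),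
      ← lintegral_const_mul' _ _ (by finiteness)]
    exact lintegral_congr fun r => by ring
  · intro s _
    exact hw.mul ((aemeasurable_lintegral_cons (aemeasurable_sq_enorm ψ s)).const_mul _)

lemma exists_lintegral_densityBound_le {w : E3 → ℝ} (hw : w ∈ lpSum ℝ (3 / 2) ⊤) {ε : ℝ≥0}
    (hε : ε ≠ 0) : ∃ C : ℝ≥0, ∀ ψ : Wavefunction (n + 1) σ V,
      ∫⁻ r, ‖w r‖ₑ * densityBound ψ r ≤ ε * kinetic 0 ψ + C := by
  obtain ⟨C, hC⟩ := exists_potentialForm_le (σ := σ) (V := V) (n := n) hw (ε := ε / (n + 1))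
    (by positivity)
  refine ⟨(n + 1) * C, fun ψ => ?_⟩
  have hwm := (aestronglyMeasurable_of_mem_lpSum hw).enorm
  rw [lintegral_mul_densityBound hwm]
  calc _ ≤ (n + 1) * potentialForm (fun r => ‖w r‖ₑ) ψ := by
        rw [potentialForm_eq_sum hwm]
        gcongr with s _
        exact Finset.single_le_sum (f := fun i => ∫⁻ x, ‖w (x i)‖ₑ * ‖ψ.toFun x s‖ₑ ^ 2)
          (fun _ _ => zero_le) (Finset.mem_univ 0)
    _ ≤ (n + 1) * ((ε / (n + 1) : ℝ≥0) * kinetic 0 ψ + C) := by gcongr; exact hC ψ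
    _ = ((n + 1) * (ε / (n + 1)) : ℝ≥0) * kinetic 0 ψ + ((n + 1) * C : ℝ≥0) := by
        push_cast; ring
    _ = _ := by rw [mul_div_cancel₀]; positivity

/-- Young's inequality with a free weight, not optimised. It trades `|A| |ψ| |∇ψ|` for `|A|² |ψ|²`
and a small multiple of `|∇ψ|²`. -/
lemma mul_le_sq_add_sq (c : ℝ≥0) (hc : c ≠ 0) (a b : ℝ≥0∞) :
    a * b ≤ c * a ^ 2 + (c⁻¹ : ℝ≥0) * b ^ 2 := by
  rcases eq_or_ne a ⊤ with rfl | ha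
  · rw [ENNReal.top_pow (by norm_num), ENNReal.mul_top (by exact_mod_cast hc)]; simp
  rcases eq_or_ne b ⊤ with rfl | hb
  · rw [ENNReal.top_pow (by norm_num), ENNReal.mul_top (ENNReal.coe_ne_zero.2 (inv_ne_zero hc))]; simp
  lift a to ℝ≥0 using ha
  lift b to ℝ≥0 using hb
  norm_cast
  rw [← NNReal.coe_le_coe]
  push_cast
  have hc' : (0 : ℝ) < c := by positivity
  have h : (c : ℝ) * a ^ 2 + (c : ℝ)⁻¹ * b ^ 2 - a * b =
      (c : ℝ)⁻¹ * ((c * a - b / 2) ^ 2 + 3 / 4 * b ^ 2) := by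
    field_simp; ring
  have h2 : 0 ≤ (c : ℝ)⁻¹ * ((c * a - b / 2) ^ 2 + 3 / 4 * (b : ℝ) ^ 2) := by positivity
  linarith

lemma exists_lintegral_currentBound_le {A : E3 → E3} (hA : A ∈ lpSum E3 3 ⊤) {ε : ℝ≥0}
    (hε : ε ≠ 0) : ∃ C : ℝ≥0, ∀ ψ : Wavefunction (n + 1) σ V,
      ∫⁻ r, ‖A r‖ₑ * currentBound ψ r ≤ ε * kinetic 0 ψ + C := by
  -- The gradient term becomes `(n + 1) · c⁻¹ · 2 T(0) = (ε/2) T(0)`. The relative bound chosen next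
  -- makes the `|A|²` term, counted once for each of three components, contribute the other `ε/2`.
  let c : ℝ≥0 := 4 * (n + 1) / ε
  have hc : c ≠ 0 := by positivity
  obtain ⟨C, hC⟩ := exists_potentialForm_le (σ := σ) (V := V) (n := n) (sq_norm_mem_lpSum hA)
    (ε := ε / (6 * (n + 1) * c)) (by positivity)
  refine ⟨(n + 1) * (3 * c * C), fun ψ => ?_⟩
  have hAm := (aestronglyMeasurable_of_mem_lpSum hA).enorm
  have h1 : ∫⁻ r, ‖A r‖ₑ * currentBound ψ r =
      (n + 1) * ∑ k, ∑ s, ∫⁻ x, ‖A (x 0)‖ₑ * (‖ψ.toFun x s‖ₑ * ‖ψ.grad 0 k x s‖ₑ) := by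
    simp only [currentBound, Finset.mul_sum]
    rw [lintegral_finsetSum']
    · refine Finset.sum_congr rfl fun k _ => ?_
      rw [lintegral_finsetSum']
      · refine Finset.sum_congr rfl fun s _ => ?_
        rw [← lintegral_mul_lintegral_cons hAm (aemeasurable_mul_grad ψ k s),
          ← lintegral_const_mul' _ _ (by finiteness)]
        exact lintegral_congr fun r => by ring
      · intro s _
        exact hAm.mul ((aemeasurable_lintegral_cons (aemeasurable_mul_grad ψ k s)).const_mul _)
    · intro k _
      exact Finset.aemeasurable_fun_sum _ fun s _ =>
        hAm.mul ((aemeasurable_lintegral_cons (aemeasurable_mul_grad ψ k s)).const_mul _)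
  have h2 : ∀ k s, ∫⁻ x, ‖A (x 0)‖ₑ * (‖ψ.toFun x s‖ₑ * ‖ψ.grad 0 k x s‖ₑ) ≤
      c * (∫⁻ x, ‖‖A (x 0)‖ ^ 2‖ₑ * ‖ψ.toFun x s‖ₑ ^ 2) +
        (c⁻¹ : ℝ≥0) * ∫⁻ x, ‖ψ.grad 0 k x s‖ₑ ^ 2 := by
    intro k s
    rw [← lintegral_const_mul' _ _ (by simp), ← lintegral_const_mul' _ _ (by simp),
      ← lintegral_add_right' _ (((ψ.grad_memLp 0 k s).1.enorm.pow_const 2).const_mul _)]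
    refine lintegral_mono fun x => ?_
    rw [enorm_pow, enorm_norm, ← mul_assoc, ← mul_pow]
    exact mul_le_sq_add_sq c hc _ _
  have h3 : ∑ s, ∫⁻ x, ‖‖A (x 0)‖ ^ 2‖ₑ * ‖ψ.toFun x s‖ₑ ^ 2 ≤
      potentialForm (fun r => ‖‖A r‖ ^ 2‖ₑ) ψ := by
    rw [potentialForm_eq_sum (aestronglyMeasurable_of_mem_lpSum (sq_norm_mem_lpSum hA)).enorm]
    gcongr with s _
    exact Finset.single_le_sum (f := fun i => ∫⁻ x, ‖‖A (x i)‖ ^ 2‖ₑ * ‖ψ.toFun x s‖ₑ ^ 2)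
      (fun _ _ => zero_le) (Finset.mem_univ 0)
  have h4 : ∑ k, ∑ s, ∫⁻ x, ‖ψ.grad 0 k x s‖ₑ ^ 2 ≤ 2 * kinetic 0 ψ := by
    rw [two_mul_kinetic_zero_eq]
    exact Finset.single_le_sum (f := fun i => ∑ k, ∑ s, ∫⁻ x, ‖ψ.grad i k x s‖ₑ ^ 2)
      (fun _ _ => zero_le) (Finset.mem_univ 0)
  rw [h1]
  calc _ ≤ (n + 1) * ∑ k, ∑ s, (c * (∫⁻ x, ‖‖A (x 0)‖ ^ 2‖ₑ * ‖ψ.toFun x s‖ₑ ^ 2) +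
        (c⁻¹ : ℝ≥0) * ∫⁻ x, ‖ψ.grad 0 k x s‖ₑ ^ 2) := by
        gcongr with k _ s _; exact h2 k s
    _ = (n + 1) * (3 * c * (∑ s, ∫⁻ x, ‖‖A (x 0)‖ ^ 2‖ₑ * ‖ψ.toFun x s‖ₑ ^ 2) +
        (c⁻¹ : ℝ≥0) * ∑ k, ∑ s, ∫⁻ x, ‖ψ.grad 0 k x s‖ₑ ^ 2) := by
        simp only [Finset.sum_add_distrib, ← Finset.mul_sum, Finset.sum_const, Finset.card_univ,
          Fintype.card_fin, nsmul_eq_mul]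
        push_cast
        ring
    _ ≤ (n + 1) * (3 * c * ((ε / (6 * (n + 1) * c) : ℝ≥0) * kinetic 0 ψ + C) +
        (c⁻¹ : ℝ≥0) * (2 * kinetic 0 ψ)) := by
        gcongr
        exact h3.trans (hC ψ)
    _ = ((n + 1) * (3 * c * (ε / (6 * (n + 1) * c)) + c⁻¹ * 2) : ℝ≥0) * kinetic 0 ψ +
        ((n + 1) * (3 * c * C) : ℝ≥0) := by
        push_cast; ring
    _ = _ := by
        congr 3
        simp only [c]
        field_simp
        norm_num

/-- The kinetic energy `tr(γ T(0))` of a mixed state. -/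
noncomputable def mixedKinetic (γ : MixedState (n + 1) σ V) : ℝ≥0∞ :=
  ∑' m, (γ.weight m : ℝ≥0∞) * kinetic 0 (γ.state m)

lemma tsum_weight (γ : MixedState (n + 1) σ V) : ∑' m, (γ.weight m : ℝ≥0∞) = 1 := by
  rw [← ENNReal.coe_tsum γ.hasSum_weight.summable, γ.hasSum_weight.tsum_eq, ENNReal.coe_one]

lemma tsum_weight_mul_le (γ : MixedState (n + 1) σ V) {f g : Wavefunction (n + 1) σ V → ℝ≥0∞}
    {a C : ℝ≥0} (h : ∀ ψ, f ψ ≤ a * g ψ + C) :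
    ∑' m, (γ.weight m : ℝ≥0∞) * f (γ.state m) ≤
      a * (∑' m, (γ.weight m : ℝ≥0∞) * g (γ.state m)) + C := by
  calc _ ≤ ∑' m, (a * ((γ.weight m : ℝ≥0∞) * g (γ.state m)) + C * (γ.weight m : ℝ≥0∞)) := by
        refine ENNReal.tsum_le_tsum fun m => (mul_le_mul_right (h _) _).trans (le_of_eq ?_)
        ring
    _ = _ := by
        rw [ENNReal.tsum_add, ENNReal.tsum_mul_left, ENNReal.tsum_mul_left, tsum_weight, mul_one]

lemma neg_le_coe_sub_coe {P Q C : ℝ≥0∞} (hQ : Q ≠ ⊤) (hC : C ≠ ⊤) (h : Q ≤ P + C) :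
    -((C : ℝ≥0∞) : EReal) ≤ (P : EReal) - (Q : EReal) := by
  lift Q to ℝ≥0 using hQ
  lift C to ℝ≥0 using hC
  rcases eq_or_ne P ⊤ with rfl | hP
  · rw [EReal.coe_ennreal_top, EReal.coe_nnreal_eq_coe_real Q, EReal.top_sub_coe]
    exact le_top
  lift P to ℝ≥0 using hP
  norm_cast at h
  rw [← NNReal.coe_le_coe] at h
  push_cast at h
  simp only [EReal.coe_nnreal_eq_coe_real]
  norm_cast
  linarith

/-- The energies of mixed states are bounded from below. -/
theorem exists_le_mixedEnergy (lam : ℝ) {v : E3 → ℝ} (hv : v ∈ lpSum ℝ (3 / 2) ⊤) {A : E3 → E3}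
    (hA : A ∈ lpSum E3 3 ⊤) : ∃ C : ℝ≥0, ∀ γ : MixedState (n + 1) σ V,
      -(C : EReal) ≤ mixedEnergy lam v A γ := by
  obtain ⟨C₁, h₁⟩ := exists_kinetic_zero_le (σ := σ) (V := V) (n := n) hA
  -- The relative bound ¼ offsets the factor 4 in `exists_kinetic_zero_le`, so the negative part
  -- costs exactly one copy of `T(A)`.
  obtain ⟨C₂, h₂⟩ := exists_positivePotential_neg_le (σ := σ) (V := V) (n := n) hv
    (ε := 4⁻¹) (by simp)
  refine ⟨4⁻¹ * C₁ + C₂, fun γ => ?_⟩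
  have h : ∀ ψ : Wavefunction (n + 1) σ V, positivePotential (-v) ψ ≤
      (1 : ℝ≥0) * (kinetic A ψ + ENNReal.ofReal lam * coulomb ψ + positivePotential v ψ) +
      (4⁻¹ * C₁ + C₂ : ℝ≥0) := by
    intro ψ
    calc _ ≤ (4⁻¹ : ℝ≥0) * (4 * kinetic A ψ + C₁) + C₂ :=
          (h₂ ψ).trans (add_le_add (mul_le_mul_right (h₁ ψ) _) le_rfl)
      _ = (4⁻¹ * 4 : ℝ≥0) * kinetic A ψ + (4⁻¹ * C₁ + C₂ : ℝ≥0) := by push_cast; ring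
      _ ≤ _ := by
          refine add_le_add ?_ le_rfl
          rw [inv_mul_cancel₀ (by norm_num), add_assoc]
          exact mul_le_mul_right le_self_add _
  -- Here `tr(γ T(0)) < ∞` enters: the negative part has finite trace, so the convention for `∞ - ∞`
  -- never applies.
  have hfin : ∑' m, (γ.weight m : ℝ≥0∞) * positivePotential (-v) (γ.state m) ≠ ⊤ := by
    refine ne_top_of_le_ne_top ?_ (tsum_weight_mul_le γ h₂)
    have := γ.kinetic_ne_top
    finiteness
  have := neg_le_coe_sub_coe (C := ((4⁻¹ * C₁ + C₂ : ℝ≥0) : ℝ≥0∞)) hfin ENNReal.coe_ne_top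
    ((tsum_weight_mul_le γ h).trans (by rw [ENNReal.coe_one, one_mul]))
  exact this

lemma enorm_le_of_hasSum {E : Type*} [NormedAddCommGroup E] {f : ℕ → E} {a : E}
    (h : HasSum f a) : ‖a‖ₑ ≤ ∑' m, ‖f m‖ₑ := by
  refine le_of_tendsto' ((continuous_enorm.tendsto a).comp h.tendsto_sum_nat) fun m => ?_
  exact (enorm_sum_le _ _).trans (ENNReal.sum_le_tsum _)

/-- The pointwise series is bounded term by term and integrated by Tonelli. Measurability is asked
only of the majorants `B`, not of the densities or their sum. -/
lemma lintegral_mul_enorm_hasSum_le {E : Type*} [NormedAddCommGroup E] [NormedSpace ℝ E]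
    (γ : MixedState (n + 1) σ V)
    {w : E3 → ℝ≥0∞} (hw : AEMeasurable w) {f : Wavefunction (n + 1) σ V → E3 → E} {a : E3 → E}
    {B : Wavefunction (n + 1) σ V → E3 → ℝ≥0∞} (hB : ∀ ψ, AEMeasurable (B ψ))
    (hf : ∀ ψ r, ‖f ψ r‖ₑ ≤ B ψ r)
    (h : ∀ᵐ r, HasSum (fun m => (γ.weight m : ℝ) • f (γ.state m) r) (a r)) :
    ∫⁻ r, w r * ‖a r‖ₑ ≤ ∑' m, (γ.weight m : ℝ≥0∞) * ∫⁻ r, w r * B (γ.state m) r := by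
  calc ∫⁻ r, w r * ‖a r‖ₑ
      ≤ ∫⁻ r, ∑' m, (γ.weight m : ℝ≥0∞) * (w r * B (γ.state m) r) := by
        refine lintegral_mono_ae ?_
        filter_upwards [h] with r hr
        calc w r * ‖a r‖ₑ ≤ w r * ∑' m, (γ.weight m : ℝ≥0∞) * B (γ.state m) r := by
              gcongr
              refine (enorm_le_of_hasSum hr).trans (ENNReal.tsum_le_tsum fun m => ?_)
              rw [enorm_smul]
              refine mul_le_mul' (le_of_eq ?_) (hf _ _)
              simp [enorm_eq_nnnorm]
          _ = _ := by
              rw [← ENNReal.tsum_mul_left]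
              exact tsum_congr fun m => by ring
    _ = _ := by
        have hm : ∀ m, AEMeasurable fun r => (γ.weight m : ℝ≥0∞) * (w r * B (γ.state m) r) :=
          fun m => (hw.mul (hB _)).const_mul _
        rw [lintegral_tsum hm]
        exact tsum_congr fun m => lintegral_const_mul' _ _ (by simp)

lemma enorm_inner_le (a b : E3) : ‖inner ℝ a b‖ₑ ≤ ‖a‖ₑ * ‖b‖ₑ := by
  rw [← ofReal_norm, ← ofReal_norm, ← ofReal_norm, ← ENNReal.ofReal_mul (norm_nonneg _)]
  exact ENNReal.ofReal_le_ofReal (norm_inner_le_norm a b)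

lemma neg_le_coe_add_coe {U C : ℝ≥0∞} {a b : ℝ} (hC : C ≠ ⊤) (h : ‖a‖ₑ + ‖b‖ₑ ≤ U + C) :
    -((C : ℝ≥0∞) : EReal) ≤ (U : EReal) + (a : EReal) + (b : EReal) := by
  lift C to ℝ≥0 using hC
  rcases eq_or_ne U ⊤ with rfl | hU
  · rw [EReal.coe_ennreal_top, EReal.top_add_coe, EReal.top_add_coe]
    exact le_top
  lift U to ℝ≥0 using hU
  simp only [enorm_eq_nnnorm] at h
  norm_cast at h
  rw [← NNReal.coe_le_coe] at h
  push_cast at h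
  simp only [EReal.coe_nnreal_eq_coe_real]
  norm_cast
  rw [Real.norm_eq_abs, Real.norm_eq_abs] at h
  linarith [neg_abs_le a, neg_abs_le b]

/-- The mixed-state constrained-search functional plus the pairing with the potentials is bounded
from below. -/
theorem exists_le_constrainedSearchMixed_add (lam : ℝ) {v : E3 → ℝ}
    (hv : v ∈ lpSum ℝ (3 / 2) ⊤) {A : E3 → E3} (hA : A ∈ lpSum E3 3 ⊤) :
    ∃ C : ℝ≥0, ∀ (ρ : E3 → ℝ) (j : E3 → E3),
      -(C : EReal) ≤ constrainedSearchMixed V lam ρ j + ((∫ r, inner ℝ (A r) (j r) : ℝ) : EReal)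
        + ((∫ r, (v r + 1 / 2 * ‖A r‖ ^ 2) * ρ r : ℝ) : EReal) := by
  have hu : (fun r => v r + 1 / 2 * ‖A r‖ ^ 2) ∈ lpSum ℝ (3 / 2) ⊤ :=
    add_mem_lpSum hv (half_sq_norm_mem_lpSum hA)
  -- Each of the two pairings may use half of the kinetic energy; the nonnegative repulsion is
  -- dropped.
  obtain ⟨C₁, h₁⟩ := exists_lintegral_currentBound_le (σ := σ) (V := V) (n := n) hA
    (ε := 2⁻¹) (by simp)
  obtain ⟨C₂, h₂⟩ := exists_lintegral_densityBound_le (σ := σ) (V := V) (n := n) hu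
    (ε := 2⁻¹) (by simp)
  refine ⟨C₁ + C₂, fun ρ j => ?_⟩
  set a : ℝ := ∫ r, inner ℝ (A r) (j r)
  set b : ℝ := ∫ r, (v r + 1 / 2 * ‖A r‖ ^ 2) * ρ r
  have key : ∀ γ : MixedState (n + 1) σ V, MixedHasDensities γ ρ j →
      -((C₁ + C₂ : ℝ≥0) : EReal) ≤ ((mixedUniversalEnergy lam γ : ℝ≥0∞) : EReal) + a + b := by
    intro γ hγ
    refine neg_le_coe_add_coe (C := ((C₁ + C₂ : ℝ≥0) : ℝ≥0∞)) (by simp) ?_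
    have hU : mixedKinetic γ ≤ mixedUniversalEnergy lam γ :=
      ENNReal.tsum_le_tsum fun m => mul_le_mul_right le_self_add _
    have ha : ‖a‖ₑ ≤ (2⁻¹ : ℝ≥0) * mixedKinetic γ + C₁ := by
      calc ‖a‖ₑ ≤ ∫⁻ r, ‖A r‖ₑ * ‖j r‖ₑ :=
            (enorm_integral_le_lintegral_enorm _).trans
              (lintegral_mono fun r => enorm_inner_le _ _)
        _ ≤ _ := lintegral_mul_enorm_hasSum_le γ (aestronglyMeasurable_of_mem_lpSum hA).enorm
            aemeasurable_currentBound enorm_current_le (hγ.mono fun r hr => hr.2)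
        _ ≤ _ := tsum_weight_mul_le γ h₁
    have hb : ‖b‖ₑ ≤ (2⁻¹ : ℝ≥0) * mixedKinetic γ + C₂ := by
      calc ‖b‖ₑ ≤ ∫⁻ r, ‖v r + 1 / 2 * ‖A r‖ ^ 2‖ₑ * ‖ρ r‖ₑ :=
            (enorm_integral_le_lintegral_enorm _).trans
              (lintegral_mono fun r => (enorm_mul _ _).le)
        _ ≤ _ := lintegral_mul_enorm_hasSum_le γ (aestronglyMeasurable_of_mem_lpSum hu).enorm
            aemeasurable_densityBound enorm_density_le (hγ.mono fun r hr => hr.1)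
        _ ≤ _ := tsum_weight_mul_le γ h₂
    calc ‖a‖ₑ + ‖b‖ₑ ≤ ((2⁻¹ : ℝ≥0) * mixedKinetic γ + C₁) + ((2⁻¹ : ℝ≥0) * mixedKinetic γ + C₂) :=
          add_le_add ha hb
      _ = (2⁻¹ + 2⁻¹ : ℝ≥0) * mixedKinetic γ + (C₁ + C₂ : ℝ≥0) := by push_cast; ring
      _ ≤ _ := by
          refine add_le_add ?_ le_rfl
          rw [show (2⁻¹ + 2⁻¹ : ℝ≥0) = 1 by rw [← two_mul]; norm_num, ENNReal.coe_one, one_mul]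
          exact hU
  rw [add_assoc, ← EReal.coe_add]
  -- The pairings are real numbers that depend only on `(ρ, j)`, so they can be carried across the
  -- infimum over `γ`. If no `γ` represents the pair, the infimum is `+∞`.
  have h3 : -((C₁ + C₂ : ℝ≥0) : EReal) - ((a + b : ℝ) : EReal) ≤
      constrainedSearchMixed V lam ρ j := by
    refine le_iInf fun γ => le_iInf fun hγ => ?_
    refine EReal.sub_le_of_le_add ?_
    have := key γ hγ
    rwa [add_assoc, ← EReal.coe_add] at this
  rw [EReal.sub_le_iff_le_add (Or.inl (EReal.coe_ne_bot _)) (Or.inl (EReal.coe_ne_top _))] at h3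
  exact h3

end LowerBounds

/-! ### A smooth trial state without current -/

section SmoothStates

variable {n : ℕ} {σ : Type*} {V : Submodule ℂ (SpinConfig σ (n + 1) → ℂ)}

lemma hasWeakDeriv_fderiv {N : ℕ} {f : Config N → ℂ} (hf : ContDiff ℝ 1 f)
    (hc : HasCompactSupport f) (e : Config N) :
    HasWeakDeriv f (fun x => fderiv ℝ f x e) e := by
  intro φ hφ hφc
  have hφ1 : ContDiff ℝ 1 φ := hφ.of_le (by exact_mod_cast le_top)
  have hfe : Continuous fun x => fderiv ℝ f x e := by
    have := hf.continuous_fderiv (by simp)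
    fun_prop
  have hφe : Continuous fun x => fderiv ℝ φ x e := by
    have := hφ1.continuous_fderiv (by simp)
    fun_prop
  have h := integral_smul_fderiv_eq_neg_fderiv_smul_of_integrable (μ := volume) (v := e)
    (f := φ) (g := f)
    ((hφe.smul hf.continuous).integrable_of_hasCompactSupport hc.smul_left)
    ((hφ1.continuous.smul hfe).integrable_of_hasCompactSupport hφc.smul_right)
    ((hφ1.continuous.smul hf.continuous).integrable_of_hasCompactSupport hφc.smul_right)
    (fun x _ => hφ1.differentiable (by simp) x)
    (fun x _ => hf.differentiable (by simp) x)
  simp only [Complex.real_smul] at h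
  rw [h, neg_neg]

/-- The centres of the orbitals. -/
noncomputable def orbitalCentre (k : Fin (n + 1)) : E3 :=
  EuclideanSpace.single 0 (3 * (k : ℝ))

/-- Spacing 3 against orbital radius 1 makes the supports disjoint and leaves a gap of at least 1
between them; the gap controls the repulsion. -/
lemma three_le_dist_orbitalCentre {k l : Fin (n + 1)} (h : k ≠ l) :
    3 ≤ ‖orbitalCentre k - orbitalCentre l‖ := by
  have h1 : orbitalCentre k - orbitalCentre l =
      EuclideanSpace.single (0 : Fin 3) (3 * ((k : ℝ) - (l : ℝ))) := by
    ext i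
    fin_cases i <;> simp [orbitalCentre, mul_sub]
  rw [h1, PiLp.norm_single, norm_mul, Real.norm_eq_abs, Real.norm_eq_abs, abs_of_pos (by norm_num : (0:ℝ) < 3)]
  have h2 : (1 : ℝ) ≤ |(k : ℝ) - (l : ℝ)| := by
    have h3 : ((k : ℕ) : ℤ) - ((l : ℕ) : ℤ) ≠ 0 := by
      intro h4
      exact h (Fin.ext (by omega))
    have h5 := Int.one_le_abs h3
    exact_mod_cast h5
  linarith

/-- A bump function supported in the unit ball around the `k`-th centre. -/
noncomputable def orbital (k : Fin (n + 1)) : ContDiffBump (orbitalCentre k) :=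
  ⟨1 / 2, 1, by norm_num, by norm_num⟩

/-- The product of the orbitals, with the particles permuted by `τ`. -/
noncomputable def orbitalProduct (τ : Equiv.Perm (Fin (n + 1))) (x : Config (n + 1)) : ℝ :=
  ∏ k, orbital k (x (τ k))

lemma contDiff_orbitalProduct (τ : Equiv.Perm (Fin (n + 1))) :
    ContDiff ℝ 1 (orbitalProduct τ) :=
  contDiff_prod fun k _ => (orbital k).contDiff.comp (contDiff_apply ℝ E3 (τ k))

lemma norm_sub_lt_of_orbitalProduct_ne_zero {τ : Equiv.Perm (Fin (n + 1))} {x : Config (n + 1)}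
    (h : orbitalProduct τ x ≠ 0) (k : Fin (n + 1)) : ‖x (τ k) - orbitalCentre k‖ < 1 := by
  have h1 := Finset.prod_ne_zero_iff.1 h k (Finset.mem_univ k)
  have h2 : x (τ k) ∈ Function.support (orbital k) := h1
  rw [(orbital k).support_eq, mem_ball_iff_norm] at h2
  exact h2

lemma hasCompactSupport_orbitalProduct (τ : Equiv.Perm (Fin (n + 1))) :
    HasCompactSupport (orbitalProduct τ) := by
  refine HasCompactSupport.of_support_subset_isCompact
    (K := Set.univ.pi fun m => Metric.closedBall (orbitalCentre (τ.symm m)) 1)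
    (isCompact_univ_pi fun m => isCompact_closedBall _ _) fun x hx m _ => ?_
  have := norm_sub_lt_of_orbitalProduct_ne_zero hx (τ.symm m)
  rw [Equiv.apply_symm_apply] at this
  exact mem_closedBall_iff_norm.2 this.le

/-- If the permutations differed at `k`, particle `τ k` would lie within distance 1 of two distinct
centres. So at each point at most one term of the antisymmetrised sum survives. -/
lemma orbitalProduct_eq_of_ne_zero {τ τ' : Equiv.Perm (Fin (n + 1))} {x : Config (n + 1)}
    (h : orbitalProduct τ x ≠ 0) (h' : orbitalProduct τ' x ≠ 0) : τ = τ' := by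
  ext1 k
  by_contra hk
  have hne : k ≠ τ'.symm (τ k) := fun e => hk (by conv_rhs => rw [e]; simp)
  have h1 := norm_sub_lt_of_orbitalProduct_ne_zero h k
  have h2 := norm_sub_lt_of_orbitalProduct_ne_zero h' (τ'.symm (τ k))
  rw [Equiv.apply_symm_apply] at h2
  have h3 := three_le_dist_orbitalCentre hne
  have h4 : orbitalCentre k - orbitalCentre (τ'.symm (τ k)) =
    (x (τ k) - orbitalCentre (τ'.symm (τ k))) - (x (τ k) - orbitalCentre k) := by abel
  rw [h4] at h3
  linarith [norm_sub_le (x (τ k) - orbitalCentre (τ'.symm (τ k))) (x (τ k) - orbitalCentre k)]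

lemma one_le_norm_sub_of_orbitalProduct_ne_zero {τ : Equiv.Perm (Fin (n + 1))}
    {x : Config (n + 1)} (h : orbitalProduct τ x ≠ 0) {k l : Fin (n + 1)} (hkl : k ≠ l) :
    1 ≤ ‖x k - x l‖ := by
  have h1 := norm_sub_lt_of_orbitalProduct_ne_zero h (τ.symm k)
  have h2 := norm_sub_lt_of_orbitalProduct_ne_zero h (τ.symm l)
  rw [Equiv.apply_symm_apply] at h1 h2
  have h3 := three_le_dist_orbitalCentre (τ.symm.injective.ne hkl)
  have h4 : orbitalCentre (τ.symm k) - orbitalCentre (τ.symm l) =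
    (x k - x l) - (x k - orbitalCentre (τ.symm k)) + (x l - orbitalCentre (τ.symm l)) := by abel
  rw [h4] at h3
  linarith [norm_add_le ((x k - x l) - (x k - orbitalCentre (τ.symm k)))
    (x l - orbitalCentre (τ.symm l)), norm_sub_le (x k - x l) (x k - orbitalCentre (τ.symm k))]

/-- The antisymmetrised product of the orbitals and the spin state `χ`. -/
noncomputable def antisymProduct (χ : SpinConfig σ (n + 1) → ℂ) (x : Config (n + 1))
    (s : SpinConfig σ (n + 1)) : ℂ :=
  ∑ τ : Equiv.Perm (Fin (n + 1)),
    orbitalProduct τ x • (((Equiv.Perm.sign τ : ℤ) : ℂ) * χ (s ∘ τ))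

lemma contDiff_antisymProduct (χ : SpinConfig σ (n + 1) → ℂ) (s : SpinConfig σ (n + 1)) :
    ContDiff ℝ 1 fun x => antisymProduct χ x s :=
  ContDiff.sum fun τ _ => (contDiff_orbitalProduct τ).smul contDiff_const

lemma hasCompactSupport_antisymProduct (χ : SpinConfig σ (n + 1) → ℂ)
    (s : SpinConfig σ (n + 1)) : HasCompactSupport fun x => antisymProduct χ x s := by
  refine HasCompactSupport.of_support_subset_isCompact
    (K := ⋃ τ : Equiv.Perm (Fin (n + 1)), tsupport (orbitalProduct τ))
    (isCompact_iUnion fun τ => hasCompactSupport_orbitalProduct τ) fun x hx => ?_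
  obtain ⟨τ, -, hτ⟩ := Finset.exists_ne_zero_of_sum_ne_zero hx
  exact Set.mem_iUnion.2 ⟨τ, subset_tsupport _ (left_ne_zero_of_smul hτ)⟩

lemma exists_orbitalProduct_ne_zero {χ : SpinConfig σ (n + 1) → ℂ} {x : Config (n + 1)}
    {s : SpinConfig σ (n + 1)} (h : antisymProduct χ x s ≠ 0) :
    ∃ τ : Equiv.Perm (Fin (n + 1)), orbitalProduct τ x ≠ 0 := by
  obtain ⟨τ, -, hτ⟩ := Finset.exists_ne_zero_of_sum_ne_zero h
  exact ⟨τ, left_ne_zero_of_smul hτ⟩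

lemma antisymProduct_eq {χ : SpinConfig σ (n + 1) → ℂ} {x : Config (n + 1)}
    {τ : Equiv.Perm (Fin (n + 1))} (h : orbitalProduct τ x ≠ 0) (s : SpinConfig σ (n + 1)) :
    antisymProduct χ x s = orbitalProduct τ x • (((Equiv.Perm.sign τ : ℤ) : ℂ) * χ (s ∘ τ)) := by
  refine Finset.sum_eq_single τ (fun τ' _ hτ' => ?_) (by simp)
  have : orbitalProduct τ' x = 0 := by
    by_contra h'
    exact hτ' (orbitalProduct_eq_of_ne_zero h' h)
  rw [this, zero_smul]

lemma antisymProduct_comp (χ : SpinConfig σ (n + 1) → ℂ) (x : Config (n + 1))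
    (s : SpinConfig σ (n + 1)) (π : Equiv.Perm (Fin (n + 1))) :
    antisymProduct χ (x ∘ π) (s ∘ π) = ((Equiv.Perm.sign π : ℤ) : ℂ) * antisymProduct χ x s := by
  rw [antisymProduct, antisymProduct, Finset.mul_sum]
  refine (Finset.sum_congr rfl fun τ _ => ?_).trans (Equiv.sum_comp (Equiv.mulLeft π) _)
  have h1 : orbitalProduct (π * τ) x = orbitalProduct τ (x ∘ π) := rfl
  have h2 : s ∘ (π * τ : Equiv.Perm (Fin (n + 1))) = (s ∘ π) ∘ τ := rfl
  have h3 : ((Equiv.Perm.sign π : ℤ) : ℂ) * ((Equiv.Perm.sign π : ℤ) : ℂ) = 1 := by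
    rcases Int.units_eq_one_or (Equiv.Perm.sign π) with h | h <;> simp [h]
  simp only [Equiv.coe_mulLeft, h1, h2, Complex.real_smul, Equiv.Perm.sign_mul, Units.val_mul,
    Int.cast_mul]
  linear_combination (-(orbitalProduct τ (x ∘ π) : ℂ) * ((Equiv.Perm.sign τ : ℤ) : ℂ) *
    χ ((s ∘ π) ∘ τ)) * h3

/-- Near a point where the function is nonzero, a single permutation contributes, and the function
is a real product times a complex constant depending on `s`. Such a function has a constant phase.
-/
lemma im_conj_mul_fderiv_antisymProduct (χ : SpinConfig σ (n + 1) → ℂ) (x e : Config (n + 1))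
    (s : SpinConfig σ (n + 1)) :
    (conj (antisymProduct χ x s) * fderiv ℝ (fun x => antisymProduct χ x s) x e).im = 0 := by
  by_cases h : antisymProduct χ x s = 0
  · simp [h]
  obtain ⟨τ, hτ⟩ := exists_orbitalProduct_ne_zero h
  have hev : (fun x => antisymProduct χ x s) =ᶠ[𝓝 x]
      fun x => orbitalProduct τ x • (((Equiv.Perm.sign τ : ℤ) : ℂ) * χ (s ∘ τ)) := by
    filter_upwards [(contDiff_orbitalProduct τ).continuous.continuousAt.eventually_ne hτ]
      with y hy using antisymProduct_eq hy s
  rw [hev.fderiv_eq, antisymProduct_eq hτ,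
    fderiv_smul_const ((contDiff_orbitalProduct τ).differentiable (by simp) x)]
  generalize ((Equiv.Perm.sign τ : ℤ) : ℂ) * χ (s ∘ τ) = z
  simp
  ring

/-- Permutation invariance of `V` enters here: antisymmetrisation also permutes the spin vector. -/
lemma antisymProduct_mem {χ : SpinConfig σ (n + 1) → ℂ}
    (hVperm : ∀ (τ : Equiv.Perm (Fin (n + 1))), ∀ χ ∈ V,
      (fun s : SpinConfig σ (n + 1) => χ (s ∘ τ)) ∈ V) (hχ : χ ∈ V) (x : Config (n + 1)) :
    antisymProduct χ x ∈ V := by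
  have h : antisymProduct χ x = ∑ τ : Equiv.Perm (Fin (n + 1)),
      ((orbitalProduct τ x : ℂ) * ((Equiv.Perm.sign τ : ℤ) : ℂ)) •
        fun s : SpinConfig σ (n + 1) => χ (s ∘ τ) := by
    funext s
    simp [antisymProduct, Finset.sum_apply, mul_assoc]
  rw [h]
  exact V.sum_mem fun τ _ => V.smul_mem _ (hVperm τ χ hχ)

/-- At the configuration of the centres only the identity contributes, with value `χ s`; by
continuity, vanishing almost everywhere would force `χ s = 0`. -/
lemma lintegral_antisymProduct_ne_zero [Fintype σ] {χ : SpinConfig σ (n + 1) → ℂ} (hχ : χ ≠ 0) :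
    ∑ s, ∫⁻ x, ‖antisymProduct χ x s‖ₑ ^ 2 ≠ 0 := by
  obtain ⟨s, hs⟩ := Function.ne_iff.1 hχ
  have hcont := (contDiff_antisymProduct χ s).continuous
  intro h
  have h1 := (Finset.sum_eq_zero_iff.1 h) s (Finset.mem_univ s)
  rw [lintegral_eq_zero_iff (hcont.measurable.enorm.pow_const 2)] at h1
  have h2 : (fun x => antisymProduct χ x s) =ᵐ[volume] fun _ => 0 := by
    filter_upwards [h1] with x hx
    simpa using hx
  rw [hcont.ae_eq_iff_eq volume continuous_const] at h2
  have h3 := congrFun h2 orbitalCentre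
  have h4 : orbitalProduct 1 (orbitalCentre : Config (n + 1)) = 1 := by
    refine Finset.prod_eq_one fun k _ => (orbital k).one_of_mem_closedBall ?_
    simp [orbital]
  have h5 : orbitalProduct 1 (orbitalCentre : Config (n + 1)) ≠ 0 := by rw [h4]; exact one_ne_zero
  simp only [antisymProduct_eq h5, h4] at h3
  apply hs
  simpa using h3

/-- There is an admissible wavefunction that is continuous with compact support, has finite
repulsion energy and carries no current. -/
theorem exists_smooth_wavefunction [Fintype σ] (hV : V ≠ ⊥)
    (hVperm : ∀ (τ : Equiv.Perm (Fin (n + 1))), ∀ χ ∈ V,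
      (fun s : SpinConfig σ (n + 1) => χ (s ∘ τ)) ∈ V) :
    ∃ ψ : Wavefunction (n + 1) σ V, coulomb ψ ≠ ⊤ ∧
      (∀ i k x s, (conj (ψ.toFun x s) * ψ.grad i k x s).im = 0) ∧
      (∀ s, Continuous fun x => ψ.toFun x s) ∧ ∀ s, HasCompactSupport fun x => ψ.toFun x s := by
  obtain ⟨χ, hχV, hχ⟩ := V.exists_mem_ne_zero_of_ne_bot hV
  set I := ∑ s, ∫⁻ x, ‖antisymProduct χ x s‖ₑ ^ 2 with hI
  have hI0 : I ≠ 0 := lintegral_antisymProduct_ne_zero hχ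
  have hIt : I ≠ ⊤ := by
    rw [hI, ENNReal.sum_ne_top]
    exact fun s _ => lintegral_sq_enorm_ne_top
      ((contDiff_antisymProduct χ s).continuous.memLp_of_hasCompactSupport
        (hasCompactSupport_antisymProduct χ s))
  let Z : ℝ := (Real.sqrt I.toReal)⁻¹
  have hZ : ‖Z‖ₑ ^ 2 * I = 1 := by
    have h0 : 0 < I.toReal := ENNReal.toReal_pos hI0 hIt
    rw [← enorm_pow, Real.enorm_of_nonneg (by positivity), inv_pow, Real.sq_sqrt h0.le,
      ENNReal.ofReal_inv_of_pos h0, ENNReal.ofReal_toReal hIt, ENNReal.inv_mul_cancel hI0 hIt]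
  have hψ1 : ∀ s, ContDiff ℝ 1 fun x => Z • antisymProduct χ x s := fun s =>
    (contDiff_antisymProduct χ s).const_smul Z
  have hψc : ∀ s, HasCompactSupport fun x => Z • antisymProduct χ x s := fun s =>
    (hasCompactSupport_antisymProduct χ s).smul_left (f := fun _ => Z)
  have hψe : ∀ s (e : Config (n + 1)),
      Continuous fun x => fderiv ℝ (fun x => Z • antisymProduct χ x s) x e := fun s e => by
    have := (hψ1 s).continuous_fderiv (by simp)
    fun_prop
  let ψ : Wavefunction (n + 1) σ V :=
    { toFun := fun x s => Z • antisymProduct χ x s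
      grad := fun i k x s => fderiv ℝ (fun x => Z • antisymProduct χ x s) x (coordDir i k)
      memLp := fun s => (hψ1 s).continuous.memLp_of_hasCompactSupport (hψc s)
      grad_memLp := fun i k s => (hψe s _).memLp_of_hasCompactSupport
        ((hψc s).fderiv_apply ℝ _)
      hasWeakDeriv := fun i k s => hasWeakDeriv_fderiv (hψ1 s) (hψc s) _
      normalized := by
        simp only [enorm_smul, mul_pow]
        rw [← hZ, hI, Finset.mul_sum]
        exact Finset.sum_congr rfl fun s _ => lintegral_const_mul' _ _ (by finiteness)
      antisymm := fun τ => Eventually.of_forall fun x s => by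
        rw [antisymProduct_comp, Complex.real_smul, Complex.real_smul]
        ring
      spin_mem := Eventually.of_forall fun x => by
        have := V.smul_mem (Z : ℂ) (antisymProduct_mem hVperm hχV x)
        convert this using 1
        funext s
        simp }
  refine ⟨ψ, ?_, fun i k x s => ?_, fun s => (hψ1 s).continuous, hψc⟩
  -- On the support all particles are at distance at least 1, so the repulsion is at most the number
  -- of pairs.
  · have h1 : ∀ x s, (∑ k, ∑ l ∈ Finset.Iio k, ENNReal.ofReal ‖x k - x l‖⁻¹) *
        ‖ψ.toFun x s‖ₑ ^ 2 ≤
        (∑ k : Fin (n + 1), ∑ l ∈ Finset.Iio k, 1) * ‖ψ.toFun x s‖ₑ ^ 2 := by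
      intro x s
      by_cases h0 : ψ.toFun x s = 0
      · simp [h0]
      obtain ⟨τ, hτ⟩ := exists_orbitalProduct_ne_zero (right_ne_zero_of_smul h0)
      gcongr with k _ l hl
      rw [ENNReal.ofReal_le_one]
      exact inv_le_one_of_one_le₀
        (one_le_norm_sub_of_orbitalProduct_ne_zero hτ (Finset.mem_Iio.1 hl).ne')
    have h2 : coulomb ψ ≤ ∑ k : Fin (n + 1), ∑ l ∈ Finset.Iio k, 1 := by
      calc coulomb ψ ≤ ∑ s, ∫⁻ x, (∑ k : Fin (n + 1), ∑ l ∈ Finset.Iio k, 1) *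
            ‖ψ.toFun x s‖ₑ ^ 2 := Finset.sum_le_sum fun s _ => lintegral_mono fun x => h1 x s
        _ = _ := by
            have hne : (∑ k : Fin (n + 1), ∑ l ∈ Finset.Iio k, 1 : ℝ≥0∞) ≠ ⊤ := by
              simp [ENNReal.sum_eq_top]
            simp only [lintegral_const_mul' _ _ hne, ← Finset.mul_sum]
            rw [ψ.normalized, mul_one]
    refine ne_top_of_le_ne_top ?_ h2
    simp [ENNReal.sum_eq_top]
  · have h1 : fderiv ℝ (fun x => Z • antisymProduct χ x s) x =
        Z • fderiv ℝ (fun x => antisymProduct χ x s) x :=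
      fderiv_const_smul ((contDiff_antisymProduct χ s).differentiable (by simp) x) Z
    have h2 := im_conj_mul_fderiv_antisymProduct χ x (coordDir i k) s
    change (conj (Z • antisymProduct χ x s) *
      fderiv ℝ (fun x => Z • antisymProduct χ x s) x (coordDir i k)).im = 0
    rw [h1, smul_apply, Complex.real_smul, Complex.real_smul, map_mul,
      Complex.conj_ofReal, mul_mul_mul_comm, ← Complex.ofReal_mul, Complex.im_ofReal_mul, h2,
      mul_zero]

end SmoothStates

/-! ### Energy and density of the trial state; comparison of pure and mixed states -/

section UpperBounds

variable {n : ℕ} {σ : Type*} [Fintype σ] {V : Submodule ℂ (SpinConfig σ (n + 1) → ℂ)}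

/-- Exchanging particles `0` and `i` preserves the measure, permutes the spin configurations and
changes the wavefunction only by a sign. -/
lemma lintegral_coord_eq (w : E3 → ℝ≥0∞) (ψ : Wavefunction (n + 1) σ V) (i : Fin (n + 1)) :
    ∑ s, ∫⁻ x, w (x i) * ‖ψ.toFun x s‖ₑ ^ 2 = ∑ s, ∫⁻ x, w (x 0) * ‖ψ.toFun x s‖ₑ ^ 2 := by
  let τ : Equiv.Perm (Fin (n + 1)) := Equiv.swap 0 i
  let e : Config (n + 1) ≃ᵐ Config (n + 1) := MeasurableEquiv.piCongrLeft (fun _ => E3) τ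
  have he : ∀ x : Config (n + 1), e x = x ∘ τ := by
    intro x
    funext k
    have h := MeasurableEquiv.piCongrLeft_apply_apply (e := τ) (β := fun _ => E3) x (τ k)
    have h2 : τ (τ k) = k := Equiv.swap_apply_self _ _ k
    rw [h2] at h
    exact h
  have hmp : MeasurePreserving e volume volume := volume_measurePreserving_piCongrLeft _ τ
  rw [← Equiv.sum_comp (Equiv.arrowCongr τ (Equiv.refl σ))]
  refine Finset.sum_congr rfl fun s _ => ?_
  rw [← hmp.lintegral_comp_emb e.measurableEmbedding]
  refine lintegral_congr_ae ?_
  filter_upwards [ψ.antisymm τ] with x hx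
  have h1 : (Equiv.arrowCongr τ (Equiv.refl σ)) s = s ∘ τ := by
    funext k
    simp [τ, Equiv.arrowCongr]
  have h2 : ‖(((Equiv.Perm.sign τ : ℤ) : ℂ))‖ₑ = 1 := by
    rcases Int.units_eq_one_or (Equiv.Perm.sign τ) with h | h <;> simp [h]
  rw [h1, he, hx, enorm_mul, h2, one_mul]
  simp [τ]

lemma potentialForm_eq_lintegral {w : E3 → ℝ≥0∞} (hw : AEMeasurable w)
    (ψ : Wavefunction (n + 1) σ V) :
    potentialForm w ψ = ∫⁻ r, w r * densityBound ψ r := by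
  rw [lintegral_mul_densityBound hw, potentialForm_eq_sum hw, Finset.sum_comm]
  simp only [lintegral_coord_eq w ψ]
  simp

/-- The cross term is `2a Im(f̄ g)`. Thus without current the vector potential adds only `½|A|²` to
the energy. -/
lemma enorm_sq_add_of_im_eq_zero {f g : ℂ} (h : (conj f * g).im = 0) (a : ℝ) :
    ‖-Complex.I * g + (a : ℂ) * f‖ₑ ^ 2 = ‖g‖ₑ ^ 2 + ‖(a : ℂ) * f‖ₑ ^ 2 := by
  have h1 : ‖-Complex.I * g + (a : ℂ) * f‖ ^ 2 = ‖g‖ ^ 2 + ‖(a : ℂ) * f‖ ^ 2 := by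
    simp only [Complex.sq_norm, Complex.normSq_apply]
    simp only [Complex.mul_im, Complex.conj_re, Complex.conj_im] at h
    simp
    linear_combination 2 * a * h
  simp only [← ofReal_norm, ← ENNReal.ofReal_pow (norm_nonneg _)]
  rw [h1, ENNReal.ofReal_add (by positivity) (by positivity)]

lemma kinetic_eq_of_im_eq_zero {ψ : Wavefunction (n + 1) σ V}
    (h : ∀ i k x s, (conj (ψ.toFun x s) * ψ.grad i k x s).im = 0) {A : E3 → E3}
    (hA : AEStronglyMeasurable A) :
    kinetic A ψ = kinetic 0 ψ + 2⁻¹ * potentialForm (fun r => ‖‖A r‖ ^ 2‖ₑ) ψ := by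
  rw [kinetic, kinetic_zero_eq, ← sum_lintegral_coord_sq_eq hA, ← mul_add]
  simp only [← Finset.sum_add_distrib]
  congr 1
  refine Finset.sum_congr rfl fun i _ => Finset.sum_congr rfl fun k _ =>
    Finset.sum_congr rfl fun s _ => ?_
  rw [← lintegral_add_left' ((ψ.grad_memLp i k s).1.enorm.pow_const 2)]
  exact lintegral_congr fun x => enorm_sq_add_of_im_eq_zero (h i k x s) _

lemma continuous_cons (r : E3) : Continuous fun y : Config n => (Fin.cons r y : Config (n + 1)) :=
  continuous_const.finCons continuous_id

lemma continuous_tail : Continuous fun x : Config (n + 1) => (Fin.tail x : Config n) := by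
  unfold Fin.tail
  fun_prop

lemma hasCompactSupport_cons {F : Type*} [Zero F] {f : Config (n + 1) → F}
    (hf : HasCompactSupport f) (r : E3) :
    HasCompactSupport fun y : Config n => f (Fin.cons r y) := by
  refine HasCompactSupport.of_support_subset_isCompact
    (K := (fun x : Config (n + 1) => (Fin.tail x : Config n)) '' tsupport f)
    (hf.isCompact.image continuous_tail) fun y hy => ?_
  exact ⟨Fin.cons r y, subset_tsupport _ hy, Fin.tail_cons _ _⟩

lemma continuous_integral_cons {f : Config (n + 1) → ℝ} (hf : Continuous f)
    (hc : HasCompactSupport f) : Continuous fun r : E3 => ∫ y : Config n, f (Fin.cons r y) := by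
  rw [← continuousOn_univ]
  refine continuousOn_integral_of_compact_support
    (k := (fun x : Config (n + 1) => (Fin.tail x : Config n)) '' tsupport f)
    (hc.isCompact.image continuous_tail) ?_ ?_
  · have h : Continuous fun p : E3 × Config n => (Fin.cons p.1 p.2 : Config (n + 1)) :=
      Continuous.finCons (A := fun _ => E3) continuous_fst continuous_snd
    exact (hf.comp h).continuousOn
  · intro r y _ hy
    by_contra h
    exact hy ⟨Fin.cons r y, subset_tsupport _ h, Fin.tail_cons _ _⟩

lemma hasCompactSupport_integral_cons {f : Config (n + 1) → ℝ} (hc : HasCompactSupport f) :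
    HasCompactSupport fun r : E3 => ∫ y : Config n, f (Fin.cons r y) := by
  refine HasCompactSupport.of_support_subset_isCompact
    (K := (fun x : Config (n + 1) => x 0) '' tsupport f)
    (hc.isCompact.image (continuous_apply 0)) fun r hr => ?_
  by_contra h
  refine hr ?_
  have h0 : ∀ y : Config n, f (Fin.cons r y) = 0 := fun y => by
    by_contra hy
    exact h ⟨Fin.cons r y, subset_tsupport _ hy, by simp⟩
  simp [h0]

lemma hasCompactSupport_norm_sq {ψ : Wavefunction (n + 1) σ V}
    (hc : ∀ s, HasCompactSupport fun x => ψ.toFun x s) (s : SpinConfig σ (n + 1)) :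
    HasCompactSupport fun x => ‖ψ.toFun x s‖ ^ 2 :=
  (hc s).comp_left (g := fun z : ℂ => ‖z‖ ^ 2) (by simp)

lemma continuous_density {ψ : Wavefunction (n + 1) σ V}
    (hψ : ∀ s, Continuous fun x => ψ.toFun x s)
    (hc : ∀ s, HasCompactSupport fun x => ψ.toFun x s) : Continuous (density ψ) :=
  continuous_const.mul (continuous_finsetSum _ fun s _ =>
    continuous_integral_cons ((hψ s).norm.pow 2) (hasCompactSupport_norm_sq hc s))

lemma hasCompactSupport_density {ψ : Wavefunction (n + 1) σ V}
    (hc : ∀ s, HasCompactSupport fun x => ψ.toFun x s) : HasCompactSupport (density ψ) := by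
  refine HasCompactSupport.of_support_subset_isCompact
    (K := ⋃ s, tsupport fun r : E3 => ∫ y : Config n, ‖ψ.toFun (Fin.cons r y) s‖ ^ 2)
    (isCompact_iUnion fun s => hasCompactSupport_integral_cons
      (f := fun x => ‖ψ.toFun x s‖ ^ 2) (hasCompactSupport_norm_sq hc s))
    fun r hr => ?_
  have h : ∑ s, ∫ y : Config n, ‖ψ.toFun (Fin.cons r y) s‖ ^ 2 ≠ 0 := fun h0 => by
    rw [Function.mem_support, density, h0, mul_zero] at hr
    exact hr rfl
  obtain ⟨s, -, hs⟩ := Finset.exists_ne_zero_of_sum_ne_zero h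
  exact Set.mem_iUnion.2 ⟨s, subset_tsupport _ hs⟩

lemma density_nonneg (ψ : Wavefunction (n + 1) σ V) (r : E3) : 0 ≤ density ψ r :=
  mul_nonneg (by positivity) (Finset.sum_nonneg fun _ _ =>
    integral_nonneg fun _ => by positivity)

/-- For continuous, compactly supported wavefunctions every slice integral converges, so no Bochner
integral takes its default value 0 and the bound is exact. -/
lemma densityBound_eq_ofReal {ψ : Wavefunction (n + 1) σ V}
    (hψ : ∀ s, Continuous fun x => ψ.toFun x s)
    (hc : ∀ s, HasCompactSupport fun x => ψ.toFun x s) (r : E3) :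
    densityBound ψ r = ENNReal.ofReal (density ψ r) := by
  rw [densityBound, density, ENNReal.ofReal_mul (by positivity),
    ENNReal.ofReal_sum_of_nonneg fun s _ => integral_nonneg fun _ => by positivity]
  congr 1
  · exact_mod_cast (ENNReal.ofReal_natCast (n + 1)).symm
  refine Finset.sum_congr rfl fun s _ => ?_
  have hint : Integrable fun y : Config n => ‖ψ.toFun (Fin.cons r y) s‖ ^ 2 :=
    (((hψ s).comp (continuous_cons r)).norm.pow 2).integrable_of_hasCompactSupport
      (hasCompactSupport_cons (hasCompactSupport_norm_sq hc s) r)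
  rw [ofReal_integral_eq_lintegral_ofReal hint (Eventually.of_forall fun _ => by positivity)]
  refine lintegral_congr fun y => ?_
  rw [← ofReal_norm, ENNReal.ofReal_pow (norm_nonneg _)]

lemma current_eq_zero {ψ : Wavefunction (n + 1) σ V}
    (h : ∀ i k x s, (conj (ψ.toFun x s) * ψ.grad i k x s).im = 0) : current ψ = 0 := by
  funext r
  ext k
  have h1 : ∀ s, (∫ y : Config n, conj (ψ.toFun (Fin.cons r y) s) *
      ψ.grad 0 k (Fin.cons r y) s).im = 0 := fun s => by
    have h2 : ∀ y : Config n, conj (ψ.toFun (Fin.cons r y) s) * ψ.grad 0 k (Fin.cons r y) s =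
        ((conj (ψ.toFun (Fin.cons r y) s) * ψ.grad 0 k (Fin.cons r y) s).re : ℂ) := fun y =>
      Complex.ext (by simp) (by rw [h]; simp)
    rw [integral_congr_ae (Eventually.of_forall h2), integral_complex_ofReal]
    exact Complex.ofReal_im _
  simp [current, Complex.im_sum, h1]

lemma integrable_mul_density {ψ : Wavefunction (n + 1) σ V}
    (hψ : ∀ s, Continuous fun x => ψ.toFun x s)
    (hc : ∀ s, HasCompactSupport fun x => ψ.toFun x s) {w : E3 → ℝ}
    (hw : w ∈ lpSum ℝ (3 / 2) ⊤) : Integrable fun r => w r * density ψ r := by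
  have hwm := aestronglyMeasurable_of_mem_lpSum hw
  refine ⟨hwm.mul (continuous_density hψ hc).aestronglyMeasurable, ?_⟩
  rw [hasFiniteIntegral_iff_enorm]
  refine lt_of_le_of_lt ?_ (potentialForm_ne_top hw ψ).lt_top
  rw [potentialForm_eq_lintegral hwm.enorm]
  refine lintegral_mono fun r => ?_
  rw [enorm_mul]
  gcongr
  exact enorm_density_le ψ r

lemma lintegral_ofReal_mul_density {ψ : Wavefunction (n + 1) σ V}
    (hψ : ∀ s, Continuous fun x => ψ.toFun x s)
    (hc : ∀ s, HasCompactSupport fun x => ψ.toFun x s) {w : E3 → ℝ}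
    (hw : AEStronglyMeasurable w) :
    ∫⁻ r, ENNReal.ofReal (w r * density ψ r) = positivePotential w ψ := by
  rw [positivePotential_eq, potentialForm_eq_lintegral hw.aemeasurable.ennreal_ofReal]
  refine lintegral_congr fun r => ?_
  rw [densityBound_eq_ofReal hψ hc, ENNReal.ofReal_mul' (density_nonneg ψ r)]

lemma positivePotential_ne_top {w : E3 → ℝ} (hw : w ∈ lpSum ℝ (3 / 2) ⊤)
    (ψ : Wavefunction (n + 1) σ V) : positivePotential w ψ ≠ ⊤ := by
  refine ne_top_of_le_ne_top (potentialForm_ne_top hw ψ) ?_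
  rw [positivePotential_eq]
  exact potentialForm_mono (fun r => Real.ofReal_le_enorm _) ψ

lemma neg_mem_lpSum {w : E3 → ℝ} {p q : ℝ≥0∞} (hw : w ∈ lpSum ℝ p q) : -w ∈ lpSum ℝ p q := by
  obtain ⟨a, ha, b, hb, rfl⟩ := hw
  exact ⟨-a, MemLp.neg ha, -b, MemLp.neg hb, by abel⟩

lemma integral_mul_density {ψ : Wavefunction (n + 1) σ V}
    (hψ : ∀ s, Continuous fun x => ψ.toFun x s)
    (hc : ∀ s, HasCompactSupport fun x => ψ.toFun x s) {w : E3 → ℝ}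
    (hw : w ∈ lpSum ℝ (3 / 2) ⊤) : ∫ r, w r * density ψ r =
      (positivePotential w ψ).toReal - (positivePotential (-w) ψ).toReal := by
  rw [integral_eq_lintegral_pos_part_sub_lintegral_neg_part (integrable_mul_density hψ hc hw),
    lintegral_ofReal_mul_density hψ hc (aestronglyMeasurable_of_mem_lpSum hw),
    ← lintegral_ofReal_mul_density hψ hc (aestronglyMeasurable_of_mem_lpSum (neg_mem_lpSum hw))]
  simp only [Pi.neg_apply, neg_mul]

lemma universalEnergy_ne_top (lam : ℝ) {ψ : Wavefunction (n + 1) σ V} (hW : coulomb ψ ≠ ⊤) :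
    universalEnergy lam ψ ≠ ⊤ := by
  have := kinetic_zero_ne_top ψ
  rw [universalEnergy]
  finiteness

/-- For wavefunctions without current, the energy is the universal energy plus the pairing of the
density with `u = v + ½|A|²`. -/
theorem energy_eq_of_im_eq_zero (lam : ℝ) {ψ : Wavefunction (n + 1) σ V} (hW : coulomb ψ ≠ ⊤)
    (h : ∀ i k x s, (conj (ψ.toFun x s) * ψ.grad i k x s).im = 0)
    (hψ : ∀ s, Continuous fun x => ψ.toFun x s)
    (hc : ∀ s, HasCompactSupport fun x => ψ.toFun x s) {u : E3 → ℝ}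
    (hu : u ∈ lpSum ℝ (3 / 2) ⊤) {A : E3 → E3} (hA : A ∈ lpSum E3 3 ⊤) :
    energy lam (fun r => u r - 1 / 2 * ‖A r‖ ^ 2) A ψ =
      ((universalEnergy lam ψ : ℝ≥0∞) : EReal) + ((∫ r, u r * density ψ r : ℝ) : EReal) := by
  have hA2 := sq_norm_mem_lpSum hA
  have hv : (fun r => u r - 1 / 2 * ‖A r‖ ^ 2) ∈ lpSum ℝ (3 / 2) ⊤ :=
    sub_mem_lpSum hu (half_sq_norm_mem_lpSum hA)
  set v : E3 → ℝ := fun r => u r - 1 / 2 * ‖A r‖ ^ 2 with hvdef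
  have hD : potentialForm (fun r => ‖‖A r‖ ^ 2‖ₑ) ψ =
      positivePotential (fun r => ‖A r‖ ^ 2) ψ := by
    rw [positivePotential_eq]
    congr 1
    funext r
    exact Real.enorm_of_nonneg (by positivity)
  have hD0 : positivePotential (-fun r => ‖A r‖ ^ 2) ψ = 0 := by
    have h0 : ∀ r, ENNReal.ofReal ((-fun r => ‖A r‖ ^ 2) r) = 0 := fun r =>
      ENNReal.ofReal_of_nonpos (by simp)
    simp only [positivePotential, h0]
    simp
  have hint : ∫ r, u r * density ψ r = (positivePotential v ψ).toReal -
      (positivePotential (-v) ψ).toReal +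
      1 / 2 * (positivePotential (fun r => ‖A r‖ ^ 2) ψ).toReal := by
    have h1 := integral_mul_density hψ hc hv
    have h2 := integral_mul_density hψ hc hA2
    rw [hD0, ENNReal.toReal_zero, sub_zero] at h2
    rw [← h1, ← h2, ← integral_const_mul, ← integral_add (integrable_mul_density hψ hc hv)
      ((integrable_mul_density hψ hc hA2).const_mul _)]
    refine integral_congr_ae (Eventually.of_forall fun r => ?_)
    simp only [hvdef]
    ring
  rw [energy, kinetic_eq_of_im_eq_zero h (aestronglyMeasurable_of_mem_lpSum hA), hD, hint,
    universalEnergy]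
  have hK := kinetic_zero_ne_top ψ
  have hP := positivePotential_ne_top hv ψ
  have hN := positivePotential_ne_top (neg_mem_lpSum hv) ψ
  have hQ := positivePotential_ne_top hA2 ψ
  have hL : ENNReal.ofReal lam * coulomb ψ ≠ ⊤ := by finiteness
  -- All five quantities are finite, so the identity in the extended reals reduces to one between
  -- real numbers.
  generalize positivePotential v ψ = P at *
  generalize positivePotential (-v) ψ = M at *
  generalize positivePotential (fun r => ‖A r‖ ^ 2) ψ = Q at *
  generalize ENNReal.ofReal lam * coulomb ψ = W at *
  generalize kinetic 0 ψ = K at *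
  lift P to ℝ≥0 using hP
  lift M to ℝ≥0 using hN
  lift Q to ℝ≥0 using hQ
  lift W to ℝ≥0 using hL
  lift K to ℝ≥0 using hK
  have h2 : (2⁻¹ : ℝ≥0∞) = ((2⁻¹ : ℝ≥0) : ℝ≥0∞) := by simp
  rw [h2]
  norm_cast
  simp only [EReal.coe_nnreal_eq_coe_real, ENNReal.coe_toReal]
  norm_cast
  push_cast
  ring

/-- A wavefunction as a mixed state. -/
def Wavefunction.toMixedState (ψ : Wavefunction (n + 1) σ V) : MixedState (n + 1) σ V where
  weight := Pi.single 0 1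
  state := fun _ => ψ
  hasSum_weight := hasSum_pi_single 0 1
  kinetic_ne_top := by
    rw [tsum_eq_single 0 fun m hm => by simp [hm]]
    simpa using kinetic_zero_ne_top ψ

lemma tsum_toMixedState_weight_mul (ψ : Wavefunction (n + 1) σ V)
    (f : Wavefunction (n + 1) σ V → ℝ≥0∞) :
    ∑' m, (ψ.toMixedState.weight m : ℝ≥0∞) * f (ψ.toMixedState.state m) = f ψ := by
  rw [tsum_eq_single 0 fun m hm => by simp [Wavefunction.toMixedState, hm]]
  simp [Wavefunction.toMixedState]

/-- A pure state is a mixed state of the same energy. The inequality carries lower bounds from mixed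
to pure states and upper bounds from pure to mixed ones. -/
lemma groundEnergyMixed_le (lam : ℝ) (v : E3 → ℝ) (A : E3 → E3) :
    groundEnergyMixed V lam v A ≤ groundEnergy V lam v A := by
  refine le_iInf fun ψ => (iInf_le _ ψ.toMixedState).trans (le_of_eq ?_)
  rw [mixedEnergy, energy, tsum_toMixedState_weight_mul ψ (positivePotential (-v)),
    tsum_toMixedState_weight_mul ψ (fun ψ => kinetic A ψ + ENNReal.ofReal lam * coulomb ψ +
      positivePotential v ψ)]

lemma constrainedSearchMixed_le (lam : ℝ) (ρ : E3 → ℝ) (j : E3 → E3) :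
    constrainedSearchMixed V lam ρ j ≤ constrainedSearch V lam ρ j := by
  refine le_iInf fun ψ => le_iInf fun hψ => ?_
  have hm : MixedHasDensities ψ.toMixedState ρ j := by
    filter_upwards [hψ.1, hψ.2] with r h1 h2
    rw [← h1, ← h2]
    constructor
    · have := hasSum_single (f := fun m => (ψ.toMixedState.weight m : ℝ) *
        density (ψ.toMixedState.state m) r) 0 fun m hm => by simp [Wavefunction.toMixedState, hm]
      simpa [Wavefunction.toMixedState] using this
    · have := hasSum_single (f := fun m => (ψ.toMixedState.weight m : ℝ) •
        current (ψ.toMixedState.state m) r) 0 fun m hm => by simp [Wavefunction.toMixedState, hm]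
      simpa [Wavefunction.toMixedState] using this
  refine le_trans (iInf₂_le ψ.toMixedState hm) (le_of_eq ?_)
  rw [mixedUniversalEnergy, tsum_toMixedState_weight_mul ψ (universalEnergy lam)]

lemma energyFromFunctional_mono {X : Set (E3 → ℝ)} {Y : Set (E3 → E3)}
    {F G : (E3 → ℝ) → (E3 → E3) → EReal} (h : ∀ ρ j, F ρ j ≤ G ρ j) (v : E3 → ℝ)
    (A : E3 → E3) : energyFromFunctional X Y F v A ≤ energyFromFunctional X Y G v A := by
  unfold energyFromFunctional
  refine iInf₂_mono fun ρ _ => ?_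
  refine iInf₂_mono fun j _ => ?_
  exact add_le_add (add_le_add (h ρ j) le_rfl) le_rfl

end UpperBounds

/-! ### Finiteness of all five expressions -/

section Finiteness

variable {n : ℕ} {σ : Type*} [Fintype σ] {V : Submodule ℂ (SpinConfig σ (n + 1) → ℂ)}

lemma energyFromFunctional_ne_top {X : Set (E3 → ℝ)} {Y : Set (E3 → E3)}
    {F : (E3 → ℝ) → (E3 → E3) → EReal} {ρ : E3 → ℝ} {j : E3 → E3} (hρ : ρ ∈ X) (hj : j ∈ Y)
    (h : F ρ j ≠ ⊤) (v : E3 → ℝ) (A : E3 → E3) : energyFromFunctional X Y F v A ≠ ⊤ := by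
  refine ne_top_of_le_ne_top ?_ ((iInf₂_le ρ hρ).trans (iInf₂_le j hj))
  exact EReal.add_ne_top (EReal.add_ne_top h (EReal.coe_ne_top _)) (EReal.coe_ne_top _)

lemma ne_bot_of_neg_le {C : ℝ≥0} {a : EReal} (h : -(C : EReal) ≤ a) : a ≠ ⊥ := by
  refine ne_bot_of_le_ne_bot ?_ h
  rw [EReal.coe_nnreal_eq_coe_real]
  exact_mod_cast EReal.coe_ne_bot (-(C : ℝ))

lemma groundEnergyMixed_ne_bot (lam : ℝ) {v : E3 → ℝ} (hv : v ∈ lpSum ℝ (3 / 2) ⊤)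
    {A : E3 → E3} (hA : A ∈ lpSum E3 3 ⊤) : groundEnergyMixed V lam v A ≠ ⊥ := by
  obtain ⟨C, hC⟩ := exists_le_mixedEnergy (V := V) lam hv hA
  exact ne_bot_of_neg_le (le_iInf hC)

lemma groundEnergy_ne_bot (lam : ℝ) {v : E3 → ℝ} (hv : v ∈ lpSum ℝ (3 / 2) ⊤)
    {A : E3 → E3} (hA : A ∈ lpSum E3 3 ⊤) : groundEnergy V lam v A ≠ ⊥ :=
  ne_bot_of_le_ne_bot (groundEnergyMixed_ne_bot lam hv hA) (groundEnergyMixed_le lam v A)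

lemma energyFromFunctional_constrainedSearchMixed_ne_bot (lam : ℝ) {v : E3 → ℝ}
    (hv : v ∈ lpSum ℝ (3 / 2) ⊤) {A : E3 → E3} (hA : A ∈ lpSum E3 3 ⊤) (X : Set (E3 → ℝ))
    (Y : Set (E3 → E3)) :
    energyFromFunctional X Y (constrainedSearchMixed V lam) v A ≠ ⊥ := by
  obtain ⟨C, hC⟩ := exists_le_constrainedSearchMixed_add (V := V) lam hv hA
  exact ne_bot_of_neg_le (le_iInf₂ fun ρ _ => le_iInf₂ fun j _ => hC ρ j)

/-- The energy obtained from the Lieb functional is at least the ground-state energy. -/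
lemma groundEnergy_le_energyFromFunctional_liebFunctional (lam : ℝ) {X' : Set (E3 → ℝ)}
    {Y' : Set (E3 → E3)} {v : E3 → ℝ} {A : E3 → E3}
    (hu : (fun r => v r + 1 / 2 * ‖A r‖ ^ 2) ∈ X') (hA : A ∈ Y') (X : Set (E3 → ℝ))
    (Y : Set (E3 → E3)) :
    groundEnergy V lam v A ≤ energyFromFunctional X Y (liebFunctional V lam X' Y') v A := by
  refine le_iInf₂ fun ρ _ => le_iInf₂ fun j _ => ?_
  set a : ℝ := ∫ r, inner ℝ (A r) (j r)
  set b : ℝ := ∫ r, (v r + 1 / 2 * ‖A r‖ ^ 2) * ρ r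
  -- The supremum is tested at `u = v + ½|A|²` and the given `A`, where `Ē(u, A) = E(v, A)`.
  have h1 : groundEnergy V lam v A - (a : EReal) - (b : EReal) ≤
      liebFunctional V lam X' Y' ρ j := by
    refine le_trans (le_of_eq ?_) ((le_iSup₂ (f := fun A' (_ : A' ∈ Y') =>
      convexified (groundEnergy V lam) (fun r => v r + 1 / 2 * ‖A r‖ ^ 2) A'
        - ((∫ r, inner ℝ (A' r) (j r) : ℝ) : EReal) - (b : EReal)) A hA).trans
      (le_iSup₂ (f := fun u (_ : u ∈ X') => ⨆ A' ∈ Y', convexified (groundEnergy V lam) u A'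
        - ((∫ r, inner ℝ (A' r) (j r) : ℝ) : EReal) - ((∫ r, u r * ρ r : ℝ) : EReal)) _ hu))
    have h2 : (fun r => v r + 1 / 2 * ‖A r‖ ^ 2 - 1 / 2 * ‖A r‖ ^ 2) = v := by
      funext r; ring
    simp only [convexified, h2]
    rfl
  rw [EReal.sub_le_iff_le_add (Or.inl (EReal.coe_ne_bot _)) (Or.inl (EReal.coe_ne_top _)),
    EReal.sub_le_iff_le_add (Or.inl (EReal.coe_ne_bot _)) (Or.inl (EReal.coe_ne_top _))] at h1
  refine h1.trans (le_of_eq ?_)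
  rw [add_assoc, add_assoc, add_comm (b : EReal)]

/-- Finiteness of all variants of the ground-state energy, for a density space and a space of
potentials with the stated closure properties. -/
theorem energies_finite (hV : V ≠ ⊥)
    (hVperm : ∀ (τ : Equiv.Perm (Fin (n + 1))), ∀ χ ∈ V,
      (fun s : SpinConfig σ (n + 1) => χ (s ∘ τ)) ∈ V)
    (lam : ℝ) {X X' : Set (E3 → ℝ)} {Y Y' : Set (E3 → E3)}
    (hX : ∀ ρ : E3 → ℝ, Continuous ρ → HasCompactSupport ρ → ρ ∈ X) (hY : 0 ∈ Y)
    (hX' : X' ⊆ lpSum ℝ (3 / 2) ⊤) (hY' : Y' ⊆ lpSum E3 3 ⊤)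
    (hadd : ∀ u ∈ X', ∀ A ∈ Y', (fun r => u r + 1 / 2 * ‖A r‖ ^ 2) ∈ X')
    (hsub : ∀ u ∈ X', ∀ A ∈ Y', (fun r => u r - 1 / 2 * ‖A r‖ ^ 2) ∈ X') :
    ∀ E ∈ ({groundEnergy V lam, groundEnergyMixed V lam,
        energyFromFunctional X Y (constrainedSearch V lam),
        energyFromFunctional X Y (constrainedSearchMixed V lam),
        energyFromFunctional X Y (liebFunctional V lam X' Y')} :
        Set ((E3 → ℝ) → (E3 → E3) → EReal)),
      (∀ v ∈ X', ∀ A ∈ Y', E v A ≠ ⊥ ∧ E v A ≠ ⊤) ∧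
      (∀ u ∈ X', ∀ A ∈ Y', convexified E u A ≠ ⊥ ∧ convexified E u A ≠ ⊤) := by
  obtain ⟨ψ, hW, him, hψ, hc⟩ := exists_smooth_wavefunction hV hVperm
  have hj : current ψ = 0 := current_eq_zero him
  have hρ : density ψ ∈ X := hX _ (continuous_density hψ hc) (hasCompactSupport_density hc)
  have hU : ((universalEnergy lam ψ : ℝ≥0∞) : EReal) ≠ ⊤ := by
    rw [Ne, EReal.coe_ennreal_eq_top_iff]
    exact universalEnergy_ne_top lam hW
  have hen : ∀ u ∈ X', ∀ A ∈ Y', energy lam (fun r => u r - 1 / 2 * ‖A r‖ ^ 2) A ψ =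
      ((universalEnergy lam ψ : ℝ≥0∞) : EReal) + ((∫ r, u r * density ψ r : ℝ) : EReal) :=
    fun u hu A hA => energy_eq_of_im_eq_zero lam hW him hψ hc (hX' hu) (hY' hA)
  have hG : ∀ v ∈ X', ∀ A ∈ Y', groundEnergy V lam v A ≠ ⊤ := by
    intro v hv A hA
    refine ne_top_of_le_ne_top ?_ (iInf_le _ ψ)
    have h := hen _ (hadd v hv A hA) A hA
    simp only [add_sub_cancel_right] at h
    rw [h]
    exact EReal.add_ne_top hU (EReal.coe_ne_top _)
  have hC : constrainedSearch V lam (density ψ) 0 ≠ ⊤ := by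
    refine ne_top_of_le_ne_top hU (iInf₂_le ψ ⟨EventuallyEq.rfl, ?_⟩)
    rw [hj]
  -- The same `ψ` is a trial state for every `(u, A)`: it gives `Ē(u, A) ≤ U + ∫ uρ`, with `U` its
  -- universal energy, while the pairing with the zero current vanishes. So the supremum is at most
  -- `U`.
  have hL : liebFunctional V lam X' Y' (density ψ) 0 ≠ ⊤ := by
    refine ne_top_of_le_ne_top hU (iSup₂_le fun u hu => iSup₂_le fun A hA => ?_)
    refine EReal.sub_le_of_le_add ?_
    refine EReal.sub_le_of_le_add ?_
    refine (iInf_le _ ψ).trans (le_of_eq ?_)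
    rw [hen u hu A hA]
    simp
  have main : ∀ E ∈ ({groundEnergy V lam, groundEnergyMixed V lam,
        energyFromFunctional X Y (constrainedSearch V lam),
        energyFromFunctional X Y (constrainedSearchMixed V lam),
        energyFromFunctional X Y (liebFunctional V lam X' Y')} :
        Set ((E3 → ℝ) → (E3 → E3) → EReal)),
      ∀ v ∈ X', ∀ A ∈ Y', E v A ≠ ⊥ ∧ E v A ≠ ⊤ := by
    intro E hE v hv A hA
    simp only [Set.mem_insert_iff, Set.mem_singleton_iff] at hE
    rcases hE with rfl | rfl | rfl | rfl | rfl
    · exact ⟨groundEnergy_ne_bot lam (hX' hv) (hY' hA), hG v hv A hA⟩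
    · exact ⟨groundEnergyMixed_ne_bot lam (hX' hv) (hY' hA),
        ne_top_of_le_ne_top (hG v hv A hA) (groundEnergyMixed_le lam v A)⟩
    · exact ⟨ne_bot_of_le_ne_bot
          (energyFromFunctional_constrainedSearchMixed_ne_bot lam (hX' hv) (hY' hA) X Y)
          (energyFromFunctional_mono (constrainedSearchMixed_le lam) v A),
        energyFromFunctional_ne_top hρ hY hC v A⟩
    · exact ⟨energyFromFunctional_constrainedSearchMixed_ne_bot lam (hX' hv) (hY' hA) X Y,
        energyFromFunctional_ne_top hρ hY
          (ne_top_of_le_ne_top hC (constrainedSearchMixed_le lam _ _)) v A⟩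
    · exact ⟨ne_bot_of_le_ne_bot (groundEnergy_ne_bot lam (hX' hv) (hY' hA))
          (groundEnergy_le_energyFromFunctional_liebFunctional lam (hadd v hv A hA) hA X Y),
        energyFromFunctional_ne_top hρ hY hL v A⟩
  -- The convexified energy at `(u, A)` is the energy at `(u - ½|A|², A)`, again an admitted pair of
  -- potentials.
  exact fun E hE => ⟨main E hE, fun u hu A hA => main E hE _ (hsub u hu A hA) A hA⟩

end Finiteness

end CDFT

theorem mainTheorem4 (n : ℕ) (σ : Type*) [Fintype σ]
    (V : Submodule ℂ (SpinConfig σ (n + 1) → ℂ)) (hV : V ≠ ⊥)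
    (hVperm : ∀ (τ : Equiv.Perm (Fin (n + 1))), ∀ χ ∈ V,
      (fun s : SpinConfig σ (n + 1) => χ (s ∘ τ)) ∈ V)
    (lam : ℝ) (hlam : 0 ≤ lam) :
    -- density space `(L¹ ∩ L³) × (L¹ ∩ L^{3/2})³`, potentials in
    -- `(L^{3/2} + L^∞) × (L³ + L^∞)³`
    (∀ E ∈ ({groundEnergy V lam, groundEnergyMixed V lam,
        energyFromFunctional (lpSpace ℝ 1 ∩ lpSpace ℝ 3) (lpSpace E3 1 ∩ lpSpace E3 (3 / 2))
          (constrainedSearch V lam),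
        energyFromFunctional (lpSpace ℝ 1 ∩ lpSpace ℝ 3) (lpSpace E3 1 ∩ lpSpace E3 (3 / 2))
          (constrainedSearchMixed V lam),
        energyFromFunctional (lpSpace ℝ 1 ∩ lpSpace ℝ 3) (lpSpace E3 1 ∩ lpSpace E3 (3 / 2))
          (liebFunctional V lam (lpSum ℝ (3 / 2) ⊤) (lpSum E3 3 ⊤))} :
        Set ((E3 → ℝ) → (E3 → E3) → EReal)),
      (∀ v ∈ lpSum ℝ (3 / 2) ⊤, ∀ A ∈ lpSum E3 3 ⊤, E v A ≠ ⊥ ∧ E v A ≠ ⊤) ∧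
      (∀ u ∈ lpSum ℝ (3 / 2) ⊤, ∀ A ∈ lpSum E3 3 ⊤,
        convexified E u A ≠ ⊥ ∧ convexified E u A ≠ ⊤)) ∧
    -- density space `L³ × (L^{3/2})³`, potentials in `L^{3/2} × (L³)³`
    (∀ E ∈ ({groundEnergy V lam, groundEnergyMixed V lam,
        energyFromFunctional (lpSpace ℝ 3) (lpSpace E3 (3 / 2)) (constrainedSearch V lam),
        energyFromFunctional (lpSpace ℝ 3) (lpSpace E3 (3 / 2)) (constrainedSearchMixed V lam),
        energyFromFunctional (lpSpace ℝ 3) (lpSpace E3 (3 / 2))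
          (liebFunctional V lam (lpSpace ℝ (3 / 2)) (lpSpace E3 3))} :
        Set ((E3 → ℝ) → (E3 → E3) → EReal)),
      (∀ v ∈ lpSpace ℝ (3 / 2), ∀ A ∈ lpSpace E3 3, E v A ≠ ⊥ ∧ E v A ≠ ⊤) ∧
      (∀ u ∈ lpSpace ℝ (3 / 2), ∀ A ∈ lpSpace E3 3,
        convexified E u A ≠ ⊥ ∧ convexified E u A ≠ ⊤)) := by
  have hmem : ∀ (p : ℝ≥0∞) (ρ : E3 → ℝ), Continuous ρ → HasCompactSupport ρ → ρ ∈ lpSpace ℝ p :=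
    fun p ρ h hc => h.memLp_of_hasCompactSupport hc
  have h0 : ∀ p : ℝ≥0∞, (0 : E3 → E3) ∈ lpSpace E3 p := fun p => MemLp.zero
  exact ⟨energies_finite hV hVperm lam (fun ρ h hc => ⟨hmem _ ρ h hc, hmem _ ρ h hc⟩)
      ⟨h0 _, h0 _⟩ subset_rfl subset_rfl
      (fun u hu A hA => add_mem_lpSum hu (half_sq_norm_mem_lpSum hA))
      (fun u hu A hA => sub_mem_lpSum hu (half_sq_norm_mem_lpSum hA)),
    energies_finite hV hVperm lam (hmem 3) (h0 _)
      (lpSpace_subset_lpSum _) (lpSpace_subset_lpSum _)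
      (fun u hu A hA => add_mem_lpSpace hu (half_sq_norm_mem_lpSpace hA))
      (fun u hu A hA => sub_mem_lpSpace hu (half_sq_norm_mem_lpSpace hA))⟩
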